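/- Work in Baire space $\mathbb N^{\mathbb N}$. A \emph{problem} $\mathsf P$ is a partial multivalued function on Baire space: a set of instances $X\in\mathbb N^{\mathbb N}$ together with a set $\mathsf P(X)\subseteq\mathbb N^{\mathbb N}$ of solutions for each instance $X$. (Natural numbers, finite objects, subsets of $\mathbb N$, relations on $\mathbb N$, sequences and pairs of such objects are coded by elements of Baire space in the standard way; in particular, finite objects are given by explicit finite codes, and subsets of and relations on $\mathbb N$ by characteristic functions.) We write $\mathsf P\le_{\mathrm W}\mathsf Q$ if there are Turing functionals $H,K$ such that, for every $\mathsf P$-instance $X$, $H(X)$ is a $\mathsf Q$-instance and, for every $\mathsf Q$-solution $\hat Y$ to $H(X)$, $K(X\oplus\hat Y)$ is a $\mathsf P$-solution to $X$; and $\mathsf P\equiv_{\mathrm W}\mathsf Q$ if $\mathsf P\le_{\mathrm W}\mathsf Q$ and $\mathsf Q\le_{\mathrm W}\mathsf P$. The parallel product $\mathsf P\times\mathsf Q$ has as instances the pairs $(X_0,X_1)$ of a $\mathsf P$-instance and a $\mathsf Q$-instance, and as solutions to $(X_0,X_1)$ the pairs $(Y_0,Y_1)$ with $Y_0\in\mathsf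 P(X_0)$ and $Y_1\in\mathsf Q(X_1)$. \begin{itemize} \item $\mathsf{ORT}_{\mathbb N}$ (Ordered Ramsey Theorem): an instance is a finite poset $(P,\le_P)$ with a colouring $c:[\mathbb N]^2\to P$ that is right-ordered, i.e. $c(x,y)\le_P c(x,y')$ whenever $x<y\le y'$; a solution is an infinite set $H\subseteq\mathbb N$ such that $c$ is constant on $[H]^2$. \item $\mathsf{ECT}$: an instance is a pair $(n,f)$ with $n\in\mathbb N$ and $f:\mathbb N\to\{0,\dots,n-1\}$; a solution is a number $b\in\mathbb N$ such that $\forall x>b\ \exists y>x\ (f(x)=f(y))$. \item For a linear order $X$, $X^\omega$ is the set of finite sequences $\langle(b_0,a_0),\dots,(b_n,a_n)\rangle$ with $b_i\in\mathbb N$, $b_0>\dots>b_n$, and each $a_i\in X$ different from the least element of $X$ (if $X$ has one), ordered as follows: a proper initial segment is smaller than its extensions; otherwise, at the first position where two sequences have different entries $(b,a)\ne(b',a')$, the sequence with entry $(b,a)$ is the larger one if and only if $b>b'$, or $b=b'$ and $a>_X a'$. \item $\mathsf{WOP}(X\mapsto X^\omega)$: an instance is a linear order $X$ on a subset of $\mathbb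 N$ together with an infinite strictly decreasing sequence $\sigma=(\sigma_i)_{i\in\mathbb N}$ in $X^\omega$; a solution is an infinite strictly decreasing sequence $(\sigma'_i)_{i\in\mathbb N}$ in $X$ contained in $\sigma$, i.e. there are indices $t_0\le t_1\le\cdots$ such that, for every $i$, $\sigma'_i$ is one of the coefficients $a_j$ occurring in $\sigma_{t_i}$. \end{itemize} \textbf{Theorem.} $\mathsf{ORT}_{\mathbb N}\ \equiv_{\mathrm W}\ \mathsf{ECT}\times\mathsf{WOP}(X\mapsto X^\omega)$. -/

import Mathlib

/-! ### Turing functionals -/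

/-- `TuringFunctional F` says that `F` is a (partial) Turing functional: given an oracle
`p : ℕ → ℕ` and an input `n`, the possibly undefined value `F p n` is computed by one oracle
algorithm that does not depend on `p`. These are the usual closure conditions for the functions
that are partial recursive relative to an oracle (compare `Nat.Partrec` and `Nat.RecursiveIn`),
uniformly in the oracle. -/
inductive TuringFunctional : ((ℕ → ℕ) → ℕ →. ℕ) → Prop
  | zero : TuringFunctional fun _ _ => Part.some 0
  | succ : TuringFunctional fun _ n => Part.some (n + 1)
  | left : TuringFunctional fun _ n => Part.some n.unpair.1
  | right : TuringFunctional fun _ n => Part.some n.unpair.2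
  | oracle : TuringFunctional fun p n => Part.some (p n)
  | pair {F G : (ℕ → ℕ) → ℕ →. ℕ} (hF : TuringFunctional F) (hG : TuringFunctional G) :
      TuringFunctional fun p n => (F p n).bind fun a => (G p n).map fun b => Nat.pair a b
  | comp {F G : (ℕ → ℕ) → ℕ →. ℕ} (hF : TuringFunctional F) (hG : TuringFunctional G) :
      TuringFunctional fun p n => (G p n).bind fun a => F p a
  | prec {F G : (ℕ → ℕ) → ℕ →. ℕ} (hF : TuringFunctional F) (hG : TuringFunctional G) :
      TuringFunctional fun p n =>
        Nat.rec (F p n.unpair.1)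
          (fun y IH => IH.bind fun i => G p (Nat.pair n.unpair.1 (Nat.pair y i))) n.unpair.2
  | rfind {F : (ℕ → ℕ) → ℕ →. ℕ} (hF : TuringFunctional F) :
      TuringFunctional fun p a =>
        Nat.rfind fun n => (F p (Nat.pair a n)).map fun m => decide (m = 0)

/-- `F` is defined on the oracle `p`, with the total function `q` as its output. -/
def FunctionalOutput (F : (ℕ → ℕ) → ℕ →. ℕ) (p q : ℕ → ℕ) : Prop :=
  ∀ n, q n ∈ F p n

/-! ### Problems and Weihrauch reducibility -/

/-- An instance-solution problem on Baire space: a partial multivalued function, given by the set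
of its instances and, for each instance, the set of its solutions. (The value of `solutions` off
`instances` plays no role.) -/
structure Problem where
  instances : Set (ℕ → ℕ)
  solutions : (ℕ → ℕ) → Set (ℕ → ℕ)

/-- The join `p ⊕ q`: `p` on the even numbers and `q` on the odd numbers. -/
def join (p q : ℕ → ℕ) : ℕ → ℕ :=
  fun n => if n % 2 = 0 then p (n / 2) else q (n / 2)

/-- The first half of `p = p₀ ⊕ p₁`. -/
def fstPart (p : ℕ → ℕ) : ℕ → ℕ := fun n => p (2 * n)

/-- The second half of `p = p₀ ⊕ p₁`. -/
def sndPart (p : ℕ → ℕ) : ℕ → ℕ := fun n => p (2 * n + 1)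

/-- Weihrauch reducibility `P ≤_W Q`. -/
def WeihrauchReducible (P Q : Problem) : Prop :=
  ∃ H K : (ℕ → ℕ) → ℕ →. ℕ, TuringFunctional H ∧ TuringFunctional K ∧
    ∀ x ∈ P.instances, ∃ x' : ℕ → ℕ, FunctionalOutput H x x' ∧ x' ∈ Q.instances ∧
      ∀ y' ∈ Q.solutions x', ∃ y : ℕ → ℕ, FunctionalOutput K (join x y') y ∧ y ∈ P.solutions x

/-- Weihrauch equivalence `P ≡_W Q`. -/
def WeihrauchEquivalent (P Q : Problem) : Prop :=
  WeihrauchReducible P Q ∧ WeihrauchReducible Q P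

/-- The parallel product `P × Q`; pairs of points of Baire space are coded by joins. -/
def Problem.parallelProd (P Q : Problem) : Problem where
  instances := {p | fstPart p ∈ P.instances ∧ sndPart p ∈ Q.instances}
  solutions p := {q | fstPart q ∈ P.solutions (fstPart p) ∧ sndPart q ∈ Q.solutions (sndPart p)}

/-! ### Codes for sets, relations and orders -/

/-- The set with characteristic function `p` (nonzero means "yes"). -/
def codedSet (p : ℕ → ℕ) : Set ℕ := {n | p n ≠ 0}

/-- The binary relation with characteristic function `p` (nonzero means "yes"). -/
def codedRel (p : ℕ → ℕ) (a b : ℕ) : Prop := p (Nat.pair a b) ≠ 0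

/-- The function `k ↦ p (k + 1)`: the second component of the pair in `ℕ × ℕ^ℕ` whose first
component is `p 0`. -/
def tailPart (p : ℕ → ℕ) : ℕ → ℕ := fun k => p (k + 1)

/-- `le` is a (reflexive) partial order on the set `X`. -/
structure IsPartialOrderOn (X : Set ℕ) (le : ℕ → ℕ → Prop) : Prop where
  refl : ∀ a ∈ X, le a a
  antisymm : ∀ a ∈ X, ∀ b ∈ X, le a b → le b a → a = b
  trans : ∀ a ∈ X, ∀ b ∈ X, ∀ c ∈ X, le a b → le b c → le a c

/-- `le` is a (reflexive) linear order on the set `X`. -/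
structure IsLinearOrderOn (X : Set ℕ) (le : ℕ → ℕ → Prop) : Prop
    extends IsPartialOrderOn X le where
  total : ∀ a ∈ X, ∀ b ∈ X, le a b ∨ le b a

/-- The strict part of a reflexive order. -/
def strictPart (le : ℕ → ℕ → Prop) (a b : ℕ) : Prop := le a b ∧ a ≠ b

/-! ### The Ordered Ramsey Theorem -/

/-- `c : [ℕ]² → {0, …, k - 1}`; only the values `c x y` with `x < y` matter. -/
def IsPairColouring (k : ℕ) (c : ℕ → ℕ → ℕ) : Prop :=
  ∀ x y, x < y → c x y < k

/-- `c` is right-ordered with respect to `le`. -/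
def IsRightOrdered (le : ℕ → ℕ → Prop) (c : ℕ → ℕ → ℕ) : Prop :=
  ∀ x y y', x < y → y ≤ y' → le (c x y) (c x y')

/-- `H` is homogeneous for the colouring `c` of pairs. -/
def IsHomogeneous (c : ℕ → ℕ → ℕ) (H : Set ℕ) : Prop :=
  ∃ a, ∀ x ∈ H, ∀ y ∈ H, x < y → c x y = a

/-- The cardinality of the finite poset given by the first half of an instance of `ORT`. -/
def ortCard (p : ℕ → ℕ) : ℕ := fstPart p 0

/-- The order of the finite poset, whose underlying set is `{0, …, ortCard p - 1}`. -/
def ortLE (p : ℕ → ℕ) : ℕ → ℕ → Prop := codedRel (tailPart (fstPart p))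

/-- The colouring of pairs given by the second half of an instance of `ORT`. -/
def ortColour (p : ℕ → ℕ) (x y : ℕ) : ℕ := sndPart p (Nat.pair x y)

/-- The Ordered Ramsey Theorem: given a finite poset and a right-ordered colouring of `[ℕ]²` by its
elements, find (the characteristic function of) an infinite homogeneous set. -/
def ORT : Problem where
  instances := {p | IsPartialOrderOn (Set.Iio (ortCard p)) (ortLE p) ∧
    IsPairColouring (ortCard p) (ortColour p) ∧ IsRightOrdered (ortLE p) (ortColour p)}
  solutions p := {q | (codedSet q).Infinite ∧ IsHomogeneous (ortColour p) (codedSet q)}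

/-! ### Eventually constant palette tail -/

/-- `ECT`: the instance `(n, f)` is given by `n = p 0` and `f = tailPart p`; the natural number
coded by `q` is `q 0`. -/
def ECT : Problem where
  instances := {p | ∀ x, tailPart p x < p 0}
  solutions p := {q | ∀ x > q 0, ∃ y > x, tailPart p x = tailPart p y}

/-! ### The well-ordering principle for `X ↦ X^ω` -/

/-- The underlying set of `X^ω`: finite sequences `⟨(b₀, a₀), …, (bₙ, aₙ)⟩` with
`b₀ > b₁ > … > bₙ` in `ℕ` and each `aᵢ` in `X` different from `0`, the least element of `X`
(if there is one). The empty sequence is allowed. -/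
def omegaPower (X : Set ℕ) (le : ℕ → ℕ → Prop) : Set (List (ℕ × ℕ)) :=
  {l | l.Pairwise (fun u v => v.1 < u.1) ∧ ∀ u ∈ l, u.2 ∈ X ∧ ¬ ∀ x ∈ X, le u.2 x}

/-- The strict order `<` of `X^ω`: a proper initial segment is smaller, and otherwise the first
entries that differ are compared, first in `ℕ` and then in `X`. -/
def omegaPowerLT (le : ℕ → ℕ → Prop) : List (ℕ × ℕ) → List (ℕ × ℕ) → Prop :=
  List.Lex (Prod.Lex (· < ·) (strictPart le))

/-- The underlying set of the linear order in an instance `(X ⊕ ≤) ⊕ σ` of `WOP`. -/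
def wopSet (p : ℕ → ℕ) : Set ℕ := codedSet (fstPart (fstPart p))

/-- The order relation in an instance of `WOP`. -/
def wopLE (p : ℕ → ℕ) : ℕ → ℕ → Prop := codedRel (sndPart (fstPart p))

/-- The sequence in `X^ω` in an instance of `WOP`; finite sequences are coded by natural numbers
through the standard computable bijection of `ℕ` with `List (ℕ × ℕ)`. -/
def wopSeq (p : ℕ → ℕ) (i : ℕ) : List (ℕ × ℕ) := Denumerable.ofNat (List (ℕ × ℕ)) (sndPart p i)

/-- The sequence `s` in `X` is contained in the sequence `σ` in `X^ω`: its terms are sub-terms of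
terms of `σ`, in the same relative order. -/
def IsContainedIn (s : ℕ → ℕ) (σ : ℕ → List (ℕ × ℕ)) : Prop :=
  ∃ t : ℕ → ℕ, (∀ i j, i < j → t i ≤ t j) ∧ ∀ i, ∃ b, (b, s i) ∈ σ (t i)

/-- The problem `WOP(X ↦ X^ω)`: given a linear order `X` (on a set of natural numbers) and an
infinite decreasing sequence `σ` in `X^ω`, find an infinite decreasing sequence in `X` that is
contained in `σ`. -/
def WOPOmegaPower : Problem where
  instances := {p | IsLinearOrderOn (wopSet p) (wopLE p) ∧
    (∀ i, wopSeq p i ∈ omegaPower (wopSet p) (wopLE p)) ∧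
    ∀ i, omegaPowerLT (wopLE p) (wopSeq p (i + 1)) (wopSeq p i)}
  solutions p := {s | (∀ i, s i ∈ wopSet p) ∧ (∀ i, strictPart (wopLE p) (s (i + 1)) (s i)) ∧
    IsContainedIn s (wopSeq p)}

/-! From `ECT × WOP` to `ORT`: given `(n, f)` and a decreasing sequence `σ` in `X^ω`, colour `x < y`
by the number of values of `f` on `[x, y)` together with the exponent of the entry of `σ x` at its
first difference from `σ y`. Both components are nondecreasing in `y`, since for later `y` the first
difference can only move left, where exponents are larger. The exponents are bounded by the leading
exponent of `σ 0`, so the palette is a finite product order. Along a homogeneous set `h 0 < h 1 <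
…`, the constant count shows that values taken after `h 0` keep returning
(`exists_value_of_distinctValues_eq`), and the constant exponent forces the coefficients at
consecutive differences to decrease in `X` (`strictPart_diffEntry`).

From `ORT` to `ECT × WOP`: code the colours by positive numbers increasing along the poset, and run
through all stages `⟨x, d⟩`, emitting a code whenever column `x` reaches a new colour. Let `v` be
the largest value emitted infinitely often, and `b` a stage after which nothing larger is emitted. A
column beyond `b` in which `v` appears can never change colour again, and there are infinitely many
such columns, because a column emits each colour at most once. Knowing `v` and `b`, one can
therefore select a homogeneous set computably (`columnSet_homogeneous`).

`ECT`, applied to the emissions, gives a `b` after which every value recurs. `WOP` gives `v`: at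
stage `t`, the coefficient at exponent `e` records `e`, the last time of a value above `e`, and the
last time of `e` itself, ordered as `ω × ω × ω*`. Each stage lowers the coefficient at the emitted
value and leaves the higher exponents alone. In a decreasing sequence of coefficients the first two
components stabilise and the third tends to infinity, so the eventual `e` bounds all recurrent
values. The first coefficient whose third component points past `b` already has the correct exponent
(`max_recurrent`). -/

open Encodable

/-! ### Functions computable relative to an oracle -/

namespace TuringFunctional

theorem of_partrec {f : ℕ →. ℕ} (hf : Nat.Partrec f) : TuringFunctional fun _ => f := by
  induction hf with
  | zero => exact zero
  | succ => exact succ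
  | left => exact left
  | right => exact right
  | pair _ _ hf hg =>
    convert hf.pair hg using 3
    simp [Seq.seq, Part.bind_map]
  | comp _ _ hf hg => exact hf.comp hg
  | prec _ _ hf hg => exact hf.prec hg
  | rfind _ hf => exact hf.rfind

end TuringFunctional

section ComputableOn

variable {α β γ δ : Type*} [Primcodable α] [Primcodable β] [Primcodable γ] [Primcodable δ]
variable {D : Set (ℕ → ℕ)}

/-- `f` is computed by a single Turing functional for all oracles in `D`. -/
def ComputableOn (D : Set (ℕ → ℕ)) (f : (ℕ → ℕ) → α → β) : Prop :=
  ∃ F, TuringFunctional F ∧ ∀ p ∈ D, ∀ a, encode (f p a) ∈ F p (encode a)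

/-- The relation `R` between oracles in `D` and elements of `α` is decidable in the oracle. -/
def DecidableOn (D : Set (ℕ → ℕ)) (R : (ℕ → ℕ) → α → Prop) : Prop :=
  ∃ χ : (ℕ → ℕ) → α → Bool, ComputableOn D χ ∧ ∀ p a, χ p a = true ↔ R p a

namespace ComputableOn

theorem of_computable {f : α → β} (hf : Computable f) : ComputableOn D fun _ a => f a :=
  ⟨_, .of_partrec hf, fun _ _ a => by simp⟩

theorem of_primrec {f : α → β} (hf : Primrec f) : ComputableOn D fun _ a => f a :=
  of_computable hf.to_comp

theorem const (b : β) : ComputableOn D fun _ (_ : α) => b := of_computable (Computable.const b)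

theorem id : ComputableOn D fun _ (a : α) => a := of_computable Computable.id

theorem oracle : ComputableOn D fun p n => p n :=
  ⟨_, .oracle, fun p _ n => by simp⟩

theorem comp {f : (ℕ → ℕ) → β → γ} {g : (ℕ → ℕ) → α → β} (hf : ComputableOn D f)
    (hg : ComputableOn D g) : ComputableOn D fun p a => f p (g p a) := by
  obtain ⟨F, hF, hf⟩ := hf
  obtain ⟨G, hG, hg⟩ := hg
  exact ⟨_, hF.comp hG, fun p hp a => Part.mem_bind (hg p hp a) (hf p hp _)⟩

theorem pair {f : (ℕ → ℕ) → α → β} {g : (ℕ → ℕ) → α → γ} (hf : ComputableOn D f)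
    (hg : ComputableOn D g) : ComputableOn D fun p a => (f p a, g p a) := by
  obtain ⟨F, hF, hf⟩ := hf
  obtain ⟨G, hG, hg⟩ := hg
  exact ⟨_, hF.pair hG, fun p hp a =>
    Part.mem_bind (hf p hp a) (Part.mem_map (Nat.pair _) (hg p hp a))⟩

theorem fst {f : (ℕ → ℕ) → α → β × γ} (hf : ComputableOn D f) :
    ComputableOn D fun p a => (f p a).1 := (of_primrec Primrec.fst).comp hf

theorem snd {f : (ℕ → ℕ) → α → β × γ} (hf : ComputableOn D f) :
    ComputableOn D fun p a => (f p a).2 := (of_primrec Primrec.snd).comp hf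

theorem map₁ {f : β → γ} (hf : Primrec f) {g : (ℕ → ℕ) → α → β} (hg : ComputableOn D g) :
    ComputableOn D fun p a => f (g p a) := (of_primrec hf).comp hg

theorem map₂ {f : β → γ → δ} (hf : Primrec₂ f) {g : (ℕ → ℕ) → α → β} {h : (ℕ → ℕ) → α → γ}
    (hg : ComputableOn D g) (hh : ComputableOn D h) :
    ComputableOn D fun p a => f (g p a) (h p a) :=
  (of_primrec (f := fun x : β × γ => f x.1 x.2) hf).comp (hg.pair hh)

theorem add {f g : (ℕ → ℕ) → α → ℕ} (hf : ComputableOn D f) (hg : ComputableOn D g) :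
    ComputableOn D fun p a => f p a + g p a := map₂ Primrec.nat_add hf hg

theorem mul {f g : (ℕ → ℕ) → α → ℕ} (hf : ComputableOn D f) (hg : ComputableOn D g) :
    ComputableOn D fun p a => f p a * g p a := map₂ Primrec.nat_mul hf hg

theorem sub {f g : (ℕ → ℕ) → α → ℕ} (hf : ComputableOn D f) (hg : ComputableOn D g) :
    ComputableOn D fun p a => f p a - g p a := map₂ Primrec.nat_sub hf hg

theorem div {f g : (ℕ → ℕ) → α → ℕ} (hf : ComputableOn D f) (hg : ComputableOn D g) :
    ComputableOn D fun p a => f p a / g p a := map₂ Primrec.nat_div hf hg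

theorem mod {f g : (ℕ → ℕ) → α → ℕ} (hf : ComputableOn D f) (hg : ComputableOn D g) :
    ComputableOn D fun p a => f p a % g p a := map₂ Primrec.nat_mod hf hg

theorem succ {f : (ℕ → ℕ) → α → ℕ} (hf : ComputableOn D f) :
    ComputableOn D fun p a => f p a + 1 := map₁ Primrec.succ hf

theorem natPair {f g : (ℕ → ℕ) → α → ℕ} (hf : ComputableOn D f) (hg : ComputableOn D g) :
    ComputableOn D fun p a => Nat.pair (f p a) (g p a) := map₂ Primrec₂.natPair hf hg

theorem unpair_fst {f : (ℕ → ℕ) → α → ℕ} (hf : ComputableOn D f) :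
    ComputableOn D fun p a => (Nat.unpair (f p a)).1 := (map₁ Primrec.unpair hf).fst

theorem unpair_snd {f : (ℕ → ℕ) → α → ℕ} (hf : ComputableOn D f) :
    ComputableOn D fun p a => (Nat.unpair (f p a)).2 := (map₁ Primrec.unpair hf).snd

theorem natRec {f : (ℕ → ℕ) → α → β} {g : (ℕ → ℕ) → α × ℕ × β → β} {h : (ℕ → ℕ) → α → ℕ}
    (hf : ComputableOn D f) (hg : ComputableOn D g) (hh : ComputableOn D h) :
    ComputableOn D fun p a => Nat.rec (motive := fun _ => β) (f p a)
      (fun y ih => g p (a, y, ih)) (h p a) := by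
  have key : ComputableOn D fun p (x : α × ℕ) => Nat.rec (motive := fun _ => β) (f p x.1)
      (fun y ih => g p (x.1, y, ih)) x.2 := by
    obtain ⟨F, hF, hf⟩ := hf
    obtain ⟨G, hG, hg⟩ := hg
    refine ⟨_, hF.prec hG, fun p hp x => ?_⟩
    obtain ⟨a, n⟩ := x
    simp only [encode_prod_val, encode_nat, Nat.unpair_pair]
    induction n with
    | zero => exact hf p hp a
    | succ n ih => exact Part.mem_bind ih (hg p hp (a, n, _))
  exact key.comp (id.pair hh)

/-- Both branches are evaluated before one is selected; this is harmless because both are defined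
for every oracle in `D`. -/
theorem ite {R : (ℕ → ℕ) → α → Prop} [∀ p a, Decidable (R p a)] {f g : (ℕ → ℕ) → α → β}
    (hR : DecidableOn D R) (hf : ComputableOn D f) (hg : ComputableOn D g) :
    ComputableOn D fun p a => if R p a then f p a else g p a := by
  obtain ⟨χ, hχ, h⟩ := hR
  have key : ComputableOn D fun p a => bif χ p a then f p a else g p a :=
    (of_primrec (f := fun x : Bool × β × β => bif x.1 then x.2.1 else x.2.2)
      (Primrec.cond .fst (Primrec.fst.comp .snd) (Primrec.snd.comp .snd))).comp
      (hχ.pair (hf.pair hg))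
  convert key using 3 with p a
  by_cases hr : R p a
  · simp [hr, (h p a).2 hr]
  · simp [hr, Bool.eq_false_iff.2 (mt (h p a).1 hr)]

end ComputableOn

namespace DecidableOn

theorem comp {R : (ℕ → ℕ) → β → Prop} {g : (ℕ → ℕ) → α → β} (hR : DecidableOn D R)
    (hg : ComputableOn D g) : DecidableOn D fun p a => R p (g p a) := by
  obtain ⟨χ, hχ, h⟩ := hR
  exact ⟨_, hχ.comp hg, fun p a => h p _⟩

theorem rel {R : β → γ → Prop} (hR : PrimrecRel R) {f : (ℕ → ℕ) → α → β} {g : (ℕ → ℕ) → α → γ}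
    (hf : ComputableOn D f) (hg : ComputableOn D g) :
    DecidableOn D fun p a => R (f p a) (g p a) := by
  obtain ⟨_, h⟩ := hR
  exact ⟨_, (ComputableOn.of_primrec h).comp (hf.pair hg), fun p a => by simp⟩

theorem eq [DecidableEq β] {f g : (ℕ → ℕ) → α → β} (hf : ComputableOn D f)
    (hg : ComputableOn D g) : DecidableOn D fun p a => f p a = g p a := rel Primrec.eq hf hg

theorem lt {f g : (ℕ → ℕ) → α → ℕ} (hf : ComputableOn D f)
    (hg : ComputableOn D g) : DecidableOn D fun p a => f p a < g p a := rel Primrec.nat_lt hf hg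

theorem le {f g : (ℕ → ℕ) → α → ℕ} (hf : ComputableOn D f)
    (hg : ComputableOn D g) : DecidableOn D fun p a => f p a ≤ g p a := rel Primrec.nat_le hf hg

theorem not {R : (ℕ → ℕ) → α → Prop} (hR : DecidableOn D R) :
    DecidableOn D fun p a => ¬ R p a := by
  obtain ⟨χ, hχ, h⟩ := hR
  exact ⟨_, .map₁ Primrec.not hχ, fun p a => by simp [← h p a]⟩

theorem and {R S : (ℕ → ℕ) → α → Prop} (hR : DecidableOn D R) (hS : DecidableOn D S) :
    DecidableOn D fun p a => R p a ∧ S p a := by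
  obtain ⟨χ, hχ, h⟩ := hR
  obtain ⟨ψ, hψ, h'⟩ := hS
  exact ⟨_, .map₂ Primrec.and hχ hψ, fun p a => by simp [← h p a, ← h' p a]⟩

theorem or {R S : (ℕ → ℕ) → α → Prop} (hR : DecidableOn D R) (hS : DecidableOn D S) :
    DecidableOn D fun p a => R p a ∨ S p a := by
  obtain ⟨χ, hχ, h⟩ := hR
  obtain ⟨ψ, hψ, h'⟩ := hS
  exact ⟨_, .map₂ Primrec.or hχ hψ, fun p a => by simp [← h p a, ← h' p a]⟩

end DecidableOn

namespace ComputableOn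

theorem count {R : (ℕ → ℕ) → α → ℕ → Prop} [∀ p a, DecidablePred (R p a)] {h : (ℕ → ℕ) → α → ℕ}
    (hR : DecidableOn D fun p (x : α × ℕ) => R p x.1 x.2) (hh : ComputableOn D h) :
    ComputableOn D fun p a => Nat.count (R p a) (h p a) := by
  have hg : ComputableOn D fun p (x : α × ℕ × ℕ) => if R p x.1 x.2.1 then x.2.2 + 1 else x.2.2 :=
    ite (hR.comp (id.fst.pair id.snd.fst)) id.snd.snd.succ id.snd.snd
  convert natRec (const 0) hg hh using 3 with p a
  induction h p a with
  | zero => simp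
  | succ n ih => by_cases hn : R p a n <;> simp [Nat.count_succ, ih, hn]

/-- Unbounded search. -/
theorem search {R : (ℕ → ℕ) → α → ℕ → Prop} (hR : DecidableOn D fun p (x : α × ℕ) => R p x.1 x.2)
    (hne : ∀ p ∈ D, ∀ a, ∃ n, R p a n) : ComputableOn D fun p a => sInf {n | R p a n} := by
  classical
  have hg : ComputableOn D fun p (x : α × ℕ) => if R p x.1 x.2 then 0 else 1 :=
    ite hR (const 0) (const 1)
  obtain ⟨G, hG, hg⟩ := hg
  refine ⟨_, hG.rfind, fun p hp a => Nat.mem_rfind.2 ⟨?_, fun {m} hm => ?_⟩⟩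
  · have := Part.mem_map (fun m => decide (m = 0)) (hg p hp (a, sInf {n | R p a n}))
    have hmem : R p a (sInf {n | R p a n}) := Nat.sInf_mem (hne p hp a)
    simpa [hmem] using this
  · have := Part.mem_map (fun m => decide (m = 0)) (hg p hp (a, m))
    have hmem : ¬ R p a m := Nat.notMem_of_lt_sInf hm
    simpa [hmem] using this

theorem join {f g : (ℕ → ℕ) → ℕ → ℕ} (hf : ComputableOn D f) (hg : ComputableOn D g) :
    ComputableOn D fun p => join (f p) (g p) :=
  have h2 : ComputableOn D fun _ n => n / 2 := div id (const 2)
  ite (.eq (mod id (const 2)) (const 0)) (hf.comp h2) (hg.comp h2)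

theorem fstPart {f : (ℕ → ℕ) → ℕ → ℕ} (hf : ComputableOn D f) :
    ComputableOn D fun p => fstPart (f p) := hf.comp (mul (const 2) id)

theorem sndPart {f : (ℕ → ℕ) → ℕ → ℕ} (hf : ComputableOn D f) :
    ComputableOn D fun p => sndPart (f p) := hf.comp (mul (const 2) id).succ

theorem tailPart {f : (ℕ → ℕ) → ℕ → ℕ} (hf : ComputableOn D f) :
    ComputableOn D fun p => tailPart (f p) := hf.comp id.succ

end ComputableOn

theorem DecidableOn.codedRel {r : (ℕ → ℕ) → ℕ → ℕ} (hr : ComputableOn D r)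
    {f g : (ℕ → ℕ) → α → ℕ} (hf : ComputableOn D f) (hg : ComputableOn D g) :
    DecidableOn D fun p a => codedRel (r p) (f p a) (g p a) :=
  .not (.eq (hr.comp (hf.natPair hg)) (.const 0))

end ComputableOn

@[simp]
theorem fstPart_join (p q : ℕ → ℕ) : fstPart (join p q) = p := by
  ext n
  simp [fstPart, join]

@[simp]
theorem sndPart_join (p q : ℕ → ℕ) : sndPart (join p q) = q := by
  ext n
  have h : (2 * n + 1) / 2 = n := by lia
  simp [sndPart, join, h, Nat.add_mod]

/-- Reductions can thus be given by total functions that are computable only on the relevant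
oracles: unbounded searches need to halt only on genuine instances and solutions. -/
theorem WeihrauchReducible.of_computableOn {P Q : Problem} {H K : (ℕ → ℕ) → ℕ → ℕ}
    (hH : ComputableOn P.instances H) (hinst : ∀ x ∈ P.instances, H x ∈ Q.instances)
    (hK : ComputableOn
      {q | fstPart q ∈ P.instances ∧ sndPart q ∈ Q.solutions (H (fstPart q))} K)
    (hsol : ∀ x ∈ P.instances, ∀ y ∈ Q.solutions (H x), K (_root_.join x y) ∈ P.solutions x) :
    WeihrauchReducible P Q := by
  obtain ⟨F, hF, hH⟩ := hH
  obtain ⟨G, hG, hK⟩ := hK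
  refine ⟨F, G, hF, hG, fun x hx => ⟨H x, hH x hx, hinst x hx, fun y hy => ⟨_, ?_, hsol x hx y hy⟩⟩⟩
  exact hK _ (by simpa using ⟨hx, hy⟩)

theorem wopSeq_encode (p : ℕ → ℕ) (i : ℕ) (l : List (ℕ × ℕ)) (h : sndPart p i = encode l) :
    wopSeq p i = l := by
  rw [wopSeq, h]
  exact Denumerable.ofNat_encode l

theorem ComputableOn.wopSeq {α : Type*} [Primcodable α] {D : Set (ℕ → ℕ)}
    {r : (ℕ → ℕ) → ℕ → ℕ} (hr : ComputableOn D r)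
    {f : (ℕ → ℕ) → α → ℕ} (hf : ComputableOn D f) :
    ComputableOn D fun p a => wopSeq (r p) (f p a) :=
  .map₁ (Primrec.ofNat _) (hr.sndPart.comp hf)

/-! ### First differences of lexicographically decreasing sequences -/

section FirstDifference

variable {α : Type*} {r : α → α → Prop} {l l' l'' : List α} {j j' : ℕ}

/-- `l'` is lexicographically below `l`, and `j` is the first position where they differ. -/
def IsDropAt (r : α → α → Prop) (j : ℕ) (l l' : List α) : Prop :=
  (∀ i < j, l[i]? = l'[i]?) ∧ ∃ u, l[j]? = some u ∧ ∀ v, l'[j]? = some v → r v u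

theorem List.Lex.exists_isDropAt (h : List.Lex r l' l) : ∃ j, IsDropAt r j l l' := by
  induction h with
  | nil => exact ⟨0, by simp, by simp⟩
  | rel h => exact ⟨0, by simp, by simpa using h⟩
  | cons _ ih =>
    obtain ⟨j, h1, u, h2, h3⟩ := ih
    refine ⟨j + 1, fun i hi => ?_, u, by simpa using h2, by simpa using h3⟩
    cases i with
    | zero => simp
    | succ i => simpa using h1 i (by lia)

/-- Up to the smaller of the two positions all three lists agree, and the drop there is inherited
from one comparison; only when the positions coincide must two drops be composed. Transitivity is
asked only for entries of the lists, because a coded order is unconstrained outside its field. -/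
theorem IsDropAt.trans (hr : ∀ u ∈ l, ∀ v ∈ l', ∀ w ∈ l'', r w v → r v u → r w u)
    (h : IsDropAt r j l l') (h' : IsDropAt r j' l' l'') : IsDropAt r (min j j') l l'' := by
  obtain ⟨h1, u, h2, h3⟩ := h
  obtain ⟨h1', u', h2', h3'⟩ := h'
  refine ⟨fun i hi => (h1 i (by lia)).trans (h1' i (by lia)), ?_⟩
  rcases lt_trichotomy j j' with hj | rfl | hj
  · rw [min_eq_left hj.le]
    exact ⟨u, h2, fun v hv => h3 v ((h1' j hj).trans hv)⟩
  · rw [min_self]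
    exact ⟨u, h2, fun w hw => hr u (List.mem_of_getElem? h2) u' (List.mem_of_getElem? h2') w
      (List.mem_of_getElem? hw) (h3' w hw) (h3 u' h2')⟩
  · rw [min_eq_right hj.le]
    exact ⟨u', (h1 j' hj).trans h2', h3'⟩

theorem IsDropAt.getElem?_ne (hr : ∀ u, ¬ r u u) (h : IsDropAt r j l l') : l[j]? ≠ l'[j]? := by
  obtain ⟨-, u, h2, h3⟩ := h
  exact fun he => hr u (h3 u (he ▸ h2))

/-- The first position where the terms with indices `x < y` of a sequence of lists differ. -/
noncomputable def firstDiff (σ : ℕ → List α) (x y : ℕ) : ℕ :=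
  sInf {j | (σ x)[j]? ≠ (σ y)[j]? ∨ y ≤ x}

theorem IsDropAt.firstDiff_eq {σ : ℕ → List α} {x y : ℕ} (hr : ∀ u, ¬ r u u)
    (hxy : x < y) (h : IsDropAt r j (σ x) (σ y)) : firstDiff σ x y = j := by
  have hmem : j ∈ {j | (σ x)[j]? ≠ (σ y)[j]? ∨ y ≤ x} := Or.inl (h.getElem?_ne hr)
  refine le_antisymm (Nat.sInf_le hmem) (not_lt.1 fun hlt => ?_)
  rcases Nat.sInf_mem ⟨j, hmem⟩ with hne | hle
  · exact hne (h.1 _ hlt)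
  · lia

theorem isDropAt_firstDiff {σ : ℕ → List α} {S : Set α} (hirr : ∀ u, ¬ r u u)
    (htrans : ∀ u ∈ S, ∀ v ∈ S, ∀ w ∈ S, r w v → r v u → r w u)
    (hS : ∀ i, ∀ u ∈ σ i, u ∈ S) (hσ : ∀ i, List.Lex r (σ (i + 1)) (σ i))
    {x y : ℕ} (hxy : x < y) : IsDropAt r (firstDiff σ x y) (σ x) (σ y) := by
  have key : ∃ j, IsDropAt r j (σ x) (σ y) := by
    induction y, hxy using Nat.le_induction with
    | base => exact (hσ x).exists_isDropAt
    | succ y hxy ih =>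
      obtain ⟨j, hj⟩ := ih
      obtain ⟨j', hj'⟩ := (hσ y).exists_isDropAt
      exact ⟨_, hj.trans (fun u hu v hv w hw => htrans u (hS _ u hu) v (hS _ v hv) w (hS _ w hw))
        hj'⟩
  obtain ⟨j, hj⟩ := key
  rwa [hj.firstDiff_eq hirr hxy]

theorem firstDiff_anti {σ : ℕ → List α} {S : Set α} (hirr : ∀ u, ¬ r u u)
    (htrans : ∀ u ∈ S, ∀ v ∈ S, ∀ w ∈ S, r w v → r v u → r w u)
    (hS : ∀ i, ∀ u ∈ σ i, u ∈ S) (hσ : ∀ i, List.Lex r (σ (i + 1)) (σ i))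
    {x y z : ℕ} (hxy : x < y) (hyz : y ≤ z) : firstDiff σ x z ≤ firstDiff σ x y := by
  rcases hyz.eq_or_lt with rfl | hyz
  · rfl
  have h := (isDropAt_firstDiff hirr htrans hS hσ hxy).trans
    (fun u hu v hv w hw => htrans u (hS _ u hu) v (hS _ v hv) w (hS _ w hw))
    (isDropAt_firstDiff hirr htrans hS hσ hyz)
  rw [h.firstDiff_eq hirr (hxy.trans hyz)]
  exact min_le_left _ _

end FirstDifference

/-- The entry of `σ x` at the first position where it differs from `σ y`. -/
noncomputable def diffEntry (σ : ℕ → List (ℕ × ℕ)) (x y : ℕ) : ℕ × ℕ :=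
  (σ x)[firstDiff σ x y]?.getD (0, 0)

/-- The leading exponent of `σ 0`. -/
def leadingExponent (σ : ℕ → List (ℕ × ℕ)) : ℕ := ((σ 0)[0]?.getD (0, 0)).1

theorem IsPartialOrderOn.strictPart_trans {X : Set ℕ} {le : ℕ → ℕ → Prop}
    (h : IsPartialOrderOn X le) {a b c : ℕ} (ha : a ∈ X) (hb : b ∈ X) (hc : c ∈ X)
    (hab : strictPart le a b) (hbc : strictPart le b c) : strictPart le a c := by
  refine ⟨h.trans a ha b hb c hc hab.1 hbc.1, fun hac => ?_⟩
  subst hac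
  exact hab.2 (h.antisymm a ha b hb hab.1 hbc.1)

theorem prodLex_strictPart_irrefl {le : ℕ → ℕ → Prop} (u : ℕ × ℕ) :
    ¬ Prod.Lex (· < ·) (strictPart le) u u := by
  simp [Prod.lex_def, strictPart]

theorem IsPartialOrderOn.prodLex_trans {X : Set ℕ} {le : ℕ → ℕ → Prop}
    (h : IsPartialOrderOn X le) :
    ∀ u ∈ {u : ℕ × ℕ | u.2 ∈ X}, ∀ v ∈ {u : ℕ × ℕ | u.2 ∈ X}, ∀ w ∈ {u : ℕ × ℕ | u.2 ∈ X},
      Prod.Lex (· < ·) (strictPart le) w v → Prod.Lex (· < ·) (strictPart le) v u →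
      Prod.Lex (· < ·) (strictPart le) w u := by
  intro u hu v hv w hw hwv hvu
  rw [Prod.lex_def] at *
  rcases hwv with hwv | ⟨e, hwv⟩ <;> rcases hvu with hvu | ⟨e', hvu⟩
  · exact Or.inl (hwv.trans hvu)
  · exact Or.inl (e' ▸ hwv)
  · exact Or.inl (e ▸ hvu)
  · exact Or.inr ⟨e.trans e', h.strictPart_trans hw hv hu hwv hvu⟩

/-! ### First differences in decreasing sequences of `X^ω`. -/

section OmegaPower

variable {X : Set ℕ} {le : ℕ → ℕ → Prop} {σ : ℕ → List (ℕ × ℕ)}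

theorem exponent_anti {l : List (ℕ × ℕ)} (hl : l ∈ omegaPower X le) {i j : ℕ} (hij : i ≤ j)
    {u v : ℕ × ℕ} (hu : l[i]? = some u) (hv : l[j]? = some v) : v.1 ≤ u.1 := by
  rcases hij.eq_or_lt with rfl | hij
  · simp_all
  · obtain ⟨hi, rfl⟩ := List.getElem?_eq_some_iff.1 hu
    obtain ⟨hj, rfl⟩ := List.getElem?_eq_some_iff.1 hv
    exact (List.pairwise_iff_getElem.1 hl.1 i j hi hj hij).le

theorem exponent_strictAnti {l : List (ℕ × ℕ)} (hl : l ∈ omegaPower X le) {i j : ℕ} (hij : i < j)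
    {u v : ℕ × ℕ} (hu : l[i]? = some u) (hv : l[j]? = some v) : v.1 < u.1 := by
  obtain ⟨hi, rfl⟩ := List.getElem?_eq_some_iff.1 hu
  obtain ⟨hj, rfl⟩ := List.getElem?_eq_some_iff.1 hv
  exact List.pairwise_iff_getElem.1 hl.1 i j hi hj hij

theorem isDropAt_of_omegaPower (hX : IsPartialOrderOn X le) (hσ : ∀ i, σ i ∈ omegaPower X le)
    (hdec : ∀ i, omegaPowerLT le (σ (i + 1)) (σ i)) {x y : ℕ} (hxy : x < y) :
    IsDropAt (Prod.Lex (· < ·) (strictPart le)) (firstDiff σ x y) (σ x) (σ y) :=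
  isDropAt_firstDiff prodLex_strictPart_irrefl hX.prodLex_trans
    (fun i u hu => ((hσ i).2 u hu).1) hdec hxy

theorem getElem?_firstDiff (hX : IsPartialOrderOn X le) (hσ : ∀ i, σ i ∈ omegaPower X le)
    (hdec : ∀ i, omegaPowerLT le (σ (i + 1)) (σ i)) {x y : ℕ} (hxy : x < y) :
    (σ x)[firstDiff σ x y]? = some (diffEntry σ x y) := by
  obtain ⟨-, u, hu, -⟩ := isDropAt_of_omegaPower hX hσ hdec hxy
  simp [diffEntry, hu]

theorem diffEntry_fst_mono (hX : IsPartialOrderOn X le) (hσ : ∀ i, σ i ∈ omegaPower X le)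
    (hdec : ∀ i, omegaPowerLT le (σ (i + 1)) (σ i)) {x y z : ℕ} (hxy : x < y) (hyz : y ≤ z) :
    (diffEntry σ x y).1 ≤ (diffEntry σ x z).1 :=
  exponent_anti (hσ x)
    (firstDiff_anti prodLex_strictPart_irrefl hX.prodLex_trans
      (fun i u hu => ((hσ i).2 u hu).1) hdec hxy hyz)
    (getElem?_firstDiff hX hσ hdec (hxy.trans_le hyz)) (getElem?_firstDiff hX hσ hdec hxy)

/-- Exponents in `σ x` are at most its leading one, and leading exponents do not grow along `σ`.
This bound makes the colouring finite. -/
theorem diffEntry_fst_le (hX : IsPartialOrderOn X le) (hσ : ∀ i, σ i ∈ omegaPower X le)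
    (hdec : ∀ i, omegaPowerLT le (σ (i + 1)) (σ i)) {x y : ℕ} (hxy : x < y) :
    (diffEntry σ x y).1 ≤ leadingExponent σ := by
  have hxy' := getElem?_firstDiff hX hσ hdec hxy
  obtain ⟨u, hu⟩ : ∃ u, (σ x)[0]? = some u := by
    obtain ⟨h, -⟩ := List.getElem?_eq_some_iff.1 hxy'
    exact ⟨_, List.getElem?_eq_getElem (by lia)⟩
  refine (exponent_anti (hσ x) (Nat.zero_le _) hu hxy').trans ?_
  rcases Nat.eq_zero_or_pos x with rfl | hx
  · simp [leadingExponent, hu]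
  · obtain ⟨h1, v, h2, h3⟩ := isDropAt_of_omegaPower hX hσ hdec hx
    rcases Nat.eq_zero_or_pos (firstDiff σ 0 x) with h0 | h0
    · rw [h0] at h2 h3
      have := h3 u hu
      rw [Prod.lex_def] at this
      simp only [leadingExponent, h2, Option.getD_some]
      lia
    · simp [leadingExponent, h1 0 h0, hu]

theorem strictPart_diffEntry (hX : IsPartialOrderOn X le) (hσ : ∀ i, σ i ∈ omegaPower X le)
    (hdec : ∀ i, omegaPowerLT le (σ (i + 1)) (σ i)) {x y z : ℕ} (hxy : x < y) (hyz : y < z)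
    (h : (diffEntry σ x y).1 = (diffEntry σ y z).1) :
    strictPart le (diffEntry σ y z).2 (diffEntry σ x y).2 := by
  have hx := getElem?_firstDiff hX hσ hdec hxy
  have hy := getElem?_firstDiff hX hσ hdec hyz
  obtain ⟨h1, u, h2, h3⟩ := isDropAt_of_omegaPower hX hσ hdec hxy
  obtain rfl : diffEntry σ x y = u := Option.some_injective _ (hx.symm.trans h2)
  -- If `σ y` and `σ z` differed earlier, that entry would be shared by `σ x`, and its exponent
  -- would be strictly larger.
  have hle : firstDiff σ x y ≤ firstDiff σ y z := by
    by_contra! hlt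
    have := exponent_strictAnti (hσ x) hlt ((h1 _ hlt).trans hy) hx
    lia
  obtain ⟨v, hv⟩ : ∃ v, (σ y)[firstDiff σ x y]? = some v := by
    obtain ⟨h, -⟩ := List.getElem?_eq_some_iff.1 hy
    exact ⟨_, List.getElem?_eq_getElem (by lia)⟩
  have hlex := h3 v hv
  rw [Prod.lex_def] at hlex
  have hvle := exponent_anti (hσ y) hle hv hy
  -- The entry `v` of `σ y` has exponent at most that of `diffEntry σ x y`, as it lies below it, and
  -- strictly more than that of `diffEntry σ y z` if it stands further left. The two exponents being
  -- equal, the positions agree and the drop occurs in `X`.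
  have heq : firstDiff σ x y = firstDiff σ y z := by
    by_contra hne
    have := exponent_strictAnti (hσ y) (lt_of_le_of_ne hle hne) hv hy
    lia
  rw [heq] at hv
  obtain rfl : diffEntry σ y z = v := Option.some_injective _ (hy.symm.trans hv)
  rcases hlex with hlt | ⟨-, hlt⟩
  · lia
  · exact hlt

end OmegaPower

/-! ### Distinct values on intervals -/

/-- The number of distinct values below `n` that `f` takes on the interval `[x, y)`. -/
def distinctValues (n : ℕ) (f : ℕ → ℕ) (x y : ℕ) : ℕ :=
  Nat.count (fun v => 0 < Nat.count (fun d => f (x + d) = v) (y - x)) n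

theorem count_pos_iff_exists (P : ℕ → Prop) [DecidablePred P] (n : ℕ) :
    0 < Nat.count P n ↔ ∃ m < n, P m := by
  rw [Nat.count_eq_card_filter_range, Finset.card_pos]
  simp [Finset.Nonempty]

theorem value_iff {f : ℕ → ℕ} {x y v : ℕ} :
    0 < Nat.count (fun d => f (x + d) = v) (y - x) ↔ v ∈ (Finset.Ico x y).image f := by
  simp only [count_pos_iff_exists, Finset.mem_image, Finset.mem_Ico]
  constructor
  · rintro ⟨d, hd, h⟩
    exact ⟨x + d, by lia, h⟩
  · rintro ⟨z, ⟨h1, h2⟩, h⟩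
    exact ⟨z - x, by lia, by rwa [Nat.add_sub_cancel' h1]⟩

theorem distinctValues_eq_card (n : ℕ) (f : ℕ → ℕ) (x y : ℕ) :
    distinctValues n f x y =
      ((Finset.range n).filter fun v => v ∈ (Finset.Ico x y).image f).card := by
  rw [distinctValues, Nat.count_eq_card_filter_range]
  simp only [value_iff]

theorem distinctValues_le (n : ℕ) (f : ℕ → ℕ) (x y : ℕ) : distinctValues n f x y ≤ n :=
  Nat.count_le _

theorem values_subset (n : ℕ) (f : ℕ → ℕ) {x x' y y' : ℕ} (hx : x' ≤ x) (hy : y ≤ y') :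
    ((Finset.range n).filter fun v => v ∈ (Finset.Ico x y).image f) ⊆
      (Finset.range n).filter fun v => v ∈ (Finset.Ico x' y').image f :=
  Finset.monotone_filter_right _ fun _ _ hv =>
    Finset.image_subset_image (Finset.Ico_subset_Ico hx hy) hv

theorem distinctValues_mono (n : ℕ) (f : ℕ → ℕ) {x y y' : ℕ} (hy : y ≤ y') :
    distinctValues n f x y ≤ distinctValues n f x y' := by
  simp only [distinctValues_eq_card]
  exact Finset.card_le_card (values_subset n f le_rfl hy)

/-- The values on `[y, z)` are among those on `[x, z)`; equal finite cardinalities make the two sets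
equal. -/
theorem exists_value_of_distinctValues_eq {n : ℕ} {f : ℕ → ℕ} (hf : ∀ x, f x < n)
    {x y z : ℕ} (hxy : x ≤ y) (h : distinctValues n f x z = distinctValues n f y z)
    {w : ℕ} (hxw : x ≤ w) (hwz : w < z) : ∃ v, y ≤ v ∧ v < z ∧ f v = f w := by
  simp only [distinctValues_eq_card] at h
  have := Finset.eq_of_subset_of_card_le (values_subset n f hxy le_rfl) h.le
  have hmem : f w ∈ (Finset.range n).filter fun v => v ∈ (Finset.Ico x z).image f := by
    simp only [Finset.mem_filter, Finset.mem_range]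
    exact ⟨hf w, Finset.mem_image_of_mem f (Finset.mem_Ico.2 ⟨hxw, hwz⟩)⟩
  rw [← this, Finset.mem_filter] at hmem
  simpa [and_assoc] using hmem.2

/-! ### Increasing enumeration of an infinite set -/

/-- The first element of the set coded by `h` that is at least `m`. -/
noncomputable def nextElem (h : ℕ → ℕ) (m : ℕ) : ℕ := sInf {n | m ≤ n ∧ h n ≠ 0}

/-- The increasing enumeration of the set coded by `h`. -/
noncomputable def enumElem (h : ℕ → ℕ) (i : ℕ) : ℕ :=
  Nat.rec (nextElem h 0) (fun _ x => nextElem h (x + 1)) i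

theorem nextElem_spec {h : ℕ → ℕ} (hh : (codedSet h).Infinite) (m : ℕ) :
    m ≤ nextElem h m ∧ nextElem h m ∈ codedSet h := by
  obtain ⟨n, hn, hmn⟩ := hh.exists_gt m
  exact Nat.sInf_mem (s := {n | m ≤ n ∧ h n ≠ 0}) ⟨n, hmn.le, hn⟩

theorem enumElem_mem {h : ℕ → ℕ} (hh : (codedSet h).Infinite) (i : ℕ) :
    enumElem h i ∈ codedSet h := by
  cases i <;> exact (nextElem_spec hh _).2

theorem enumElem_strictMono {h : ℕ → ℕ} (hh : (codedSet h).Infinite) : StrictMono (enumElem h) :=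
  strictMono_nat_of_lt_succ fun _ => (nextElem_spec hh _).1

theorem ComputableOn.enumElem {D : Set (ℕ → ℕ)} {h : (ℕ → ℕ) → ℕ → ℕ} (hh : ComputableOn D h)
    (hinf : ∀ p ∈ D, (codedSet (h p)).Infinite) : ComputableOn D fun p => enumElem (h p) := by
  have hn : ComputableOn D fun p => nextElem (h p) :=
    search (R := fun p m n => m ≤ n ∧ h p n ≠ 0)
      (.and (.le id.fst id.snd) (.not (.eq (hh.comp id.snd) (const 0)))) fun p hp m => by
        obtain ⟨n, hn, hmn⟩ := (hinf p hp).exists_gt m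
        exact ⟨n, hmn.le, hn⟩
  exact natRec (hn.comp (const 0)) (hn.comp id.snd.snd.succ) id

/-! ### `ECT × WOP ≤ ORT` -/

/-- The sequence `a, g 0, g 1, …`. -/
def consPart (a : ℕ) (g : ℕ → ℕ) : ℕ → ℕ := fun m => if m = 0 then a else g (m - 1)

@[simp]
theorem consPart_zero (a : ℕ) (g : ℕ → ℕ) : consPart a g 0 = a := rfl

@[simp]
theorem tailPart_consPart (a : ℕ) (g : ℕ → ℕ) : tailPart (consPart a g) = g := by
  ext n
  simp [tailPart, consPart]

theorem ComputableOn.consPart {D : Set (ℕ → ℕ)} {a : (ℕ → ℕ) → ℕ}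
    {g : (ℕ → ℕ) → ℕ → ℕ} (ha : ComputableOn D fun p (_ : ℕ) => a p) (hg : ComputableOn D g) :
    ComputableOn D fun p => consPart (a p) (g p) :=
  ite (.eq id (const 0)) ha (hg.comp (sub id (const 1)))

/-- The characteristic function of the product order on `ℕ × {0, …, M - 1}`, where the pair
`(a, b)` is coded by `a * M + b`. -/
def prodOrderCode (M m : ℕ) : ℕ :=
  if m.unpair.1 / M ≤ m.unpair.2 / M ∧ m.unpair.1 % M ≤ m.unpair.2 % M then 1 else 0

theorem codedRel_prodOrderCode {M a b : ℕ} :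
    codedRel (prodOrderCode M) a b ↔ a / M ≤ b / M ∧ a % M ≤ b % M := by
  simp [codedRel, prodOrderCode]

theorem isPartialOrderOn_prodOrderCode (M : ℕ) (X : Set ℕ) :
    IsPartialOrderOn X (codedRel (prodOrderCode M)) where
  refl a _ := by simp [codedRel_prodOrderCode]
  antisymm a _ b _ h h' := by
    rw [codedRel_prodOrderCode] at h h'
    rw [← Nat.div_add_mod a M, ← Nat.div_add_mod b M, h.1.antisymm h'.1, h.2.antisymm h'.2]
  trans a _ b _ c _ h h' := by
    rw [codedRel_prodOrderCode] at *
    exact ⟨h.1.trans h'.1, h.2.trans h'.2⟩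

/-- The colouring of pairs that combines the number of values on `[x, y)` with the exponent at
which `σ x` and `σ y` first differ. -/
noncomputable def pairColour (n : ℕ) (f : ℕ → ℕ) (σ : ℕ → List (ℕ × ℕ)) (x y : ℕ) : ℕ :=
  distinctValues n f x y * (leadingExponent σ + 1) + (diffEntry σ x y).1

/-- The instance of `ORT` obtained from an instance of `ECT × WOP`. -/
noncomputable def ortInstance (p : ℕ → ℕ) : ℕ → ℕ :=
  join (consPart ((fstPart p 0 + 1) * (leadingExponent (wopSeq (sndPart p)) + 1))
      (prodOrderCode (leadingExponent (wopSeq (sndPart p)) + 1)))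
    fun m => pairColour (fstPart p 0) (tailPart (fstPart p)) (wopSeq (sndPart p))
      m.unpair.1 m.unpair.2

/-- The solution of an instance of `ECT × WOP` obtained from a homogeneous set. -/
noncomputable def ectWopSolution (q : ℕ → ℕ) : ℕ → ℕ :=
  join (fun _ => enumElem (sndPart q) 0)
    fun i => (diffEntry (wopSeq (sndPart (fstPart q))) (enumElem (sndPart q) i)
      (enumElem (sndPart q) (i + 1))).2

/-! ### Computability of the reduction of `ECT × WOP` to `ORT`. -/

section

variable {α : Type*} [Primcodable α] {D : Set (ℕ → ℕ)}

theorem ComputableOn.diffEntry {r : (ℕ → ℕ) → ℕ → ℕ} (hr : ComputableOn D r)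
    (hD : ∀ p ∈ D, r p ∈ WOPOmegaPower.instances) {f g : (ℕ → ℕ) → α → ℕ}
    (hf : ComputableOn D f) (hg : ComputableOn D g) :
    ComputableOn D fun p a => diffEntry (_root_.wopSeq (r p)) (f p a) (g p a) := by
  have h1 : ComputableOn D fun p (x : ℕ × ℕ) => firstDiff (_root_.wopSeq (r p)) x.1 x.2 := by
    refine search
      (R := fun p (x : ℕ × ℕ) j =>
        (_root_.wopSeq (r p) x.1)[j]? ≠ (_root_.wopSeq (r p) x.2)[j]? ∨ x.2 ≤ x.1)
      (.or (.not (.eq (map₂ Primrec.list_getElem? (wopSeq hr id.fst.fst) id.snd)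
        (map₂ Primrec.list_getElem? (wopSeq hr id.fst.snd) id.snd)))
        (.le id.fst.snd id.fst.fst)) fun p hp x => ?_
    by_cases hx : x.1 < x.2
    · obtain ⟨hX, hσ, hdec⟩ := hD p hp
      exact ⟨_, Or.inl ((isDropAt_of_omegaPower hX.toIsPartialOrderOn hσ hdec hx).getElem?_ne
        prodLex_strictPart_irrefl)⟩
    -- The disjunct `y ≤ x` in `firstDiff` makes the search halt on pairs that are not increasing
    -- too.
    · exact ⟨0, Or.inr (not_lt.1 hx)⟩
  exact map₂ Primrec.option_getD
    (map₂ Primrec.list_getElem? (wopSeq hr hf) (h1.comp (hf.pair hg))) (const (0, 0))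

theorem ComputableOn.leadingExponent {r : (ℕ → ℕ) → ℕ → ℕ} (hr : ComputableOn D r) :
    ComputableOn D fun p (_ : α) => leadingExponent (_root_.wopSeq (r p)) :=
  (map₂ Primrec.option_getD
    (map₂ Primrec.list_getElem? (wopSeq hr (const 0)) (const 0)) (const ((0, 0) : ℕ × ℕ))).fst

theorem ComputableOn.distinctValues {f : (ℕ → ℕ) → ℕ → ℕ} (hf : ComputableOn D f)
    {n x y : (ℕ → ℕ) → α → ℕ} (hn : ComputableOn D n) (hx : ComputableOn D x)
    (hy : ComputableOn D y) :
    ComputableOn D fun p a => distinctValues (n p a) (f p) (x p a) (y p a) :=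
  count (.lt (const 0) (count (.eq (hf.comp (add (hx.comp id.fst.fst) id.snd)) id.fst.snd)
    (sub (hy.comp id.fst) (hx.comp id.fst)))) hn

theorem ComputableOn.prodOrderCode {M : (ℕ → ℕ) → α → ℕ} (hM : ComputableOn D M)
    {m : (ℕ → ℕ) → α → ℕ} (hm : ComputableOn D m) :
    ComputableOn D fun p a => prodOrderCode (M p a) (m p a) :=
  ite (.and (.le (div hm.unpair_fst hM) (div hm.unpair_snd hM))
    (.le (mod hm.unpair_fst hM) (mod hm.unpair_snd hM))) (const 1) (const 0)

end

theorem computableOn_ortInstance :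
    ComputableOn (ECT.parallelProd WOPOmegaPower).instances ortInstance := by
  have hf := ComputableOn.oracle (D := (ECT.parallelProd WOPOmegaPower).instances) |>.fstPart
  have hs := ComputableOn.oracle (D := (ECT.parallelProd WOPOmegaPower).instances) |>.sndPart
  refine .join (.consPart (.mul (hf.comp (.const 0)).succ hs.leadingExponent.succ)
    (.prodOrderCode hs.leadingExponent.succ .id)) (.add (.mul ?_ hs.leadingExponent.succ) ?_)
  · exact hf.tailPart.distinctValues (hf.comp (.const 0)) (.unpair_fst .id) (.unpair_snd .id)
  · exact (hs.diffEntry (fun p hp => hp.2) (.unpair_fst .id) (.unpair_snd .id)).fst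

theorem computableOn_ectWopSolution : ComputableOn
    {q | fstPart q ∈ (ECT.parallelProd WOPOmegaPower).instances ∧
      sndPart q ∈ ORT.solutions (ortInstance (fstPart q))} ectWopSolution := by
  have he := ComputableOn.enumElem (.sndPart .oracle) (fun q (hq : q ∈
    {q | fstPart q ∈ (ECT.parallelProd WOPOmegaPower).instances ∧
      sndPart q ∈ ORT.solutions (ortInstance (fstPart q))}) => hq.2.1)
  exact .join (he.comp (.const 0))
    (ComputableOn.diffEntry (.sndPart (.fstPart .oracle)) (fun q hq => hq.1.2) he
      (he.comp (.succ .id))).snd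

theorem ortCard_ortInstance (p : ℕ → ℕ) : ortCard (ortInstance p) =
    (fstPart p 0 + 1) * (leadingExponent (wopSeq (sndPart p)) + 1) := by
  simp [ortCard, ortInstance]

theorem ortLE_ortInstance (p : ℕ → ℕ) : ortLE (ortInstance p) =
    codedRel (prodOrderCode (leadingExponent (wopSeq (sndPart p)) + 1)) := by
  simp [ortLE, ortInstance]

theorem ortColour_ortInstance (p : ℕ → ℕ) (x y : ℕ) : ortColour (ortInstance p) x y =
    pairColour (fstPart p 0) (tailPart (fstPart p)) (wopSeq (sndPart p)) x y := by
  simp [ortColour, ortInstance]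

section

variable {n : ℕ} {f : ℕ → ℕ} {X : Set ℕ} {le : ℕ → ℕ → Prop} {σ : ℕ → List (ℕ × ℕ)}

theorem pairColour_mod (hX : IsPartialOrderOn X le) (hσ : ∀ i, σ i ∈ omegaPower X le)
    (hdec : ∀ i, omegaPowerLT le (σ (i + 1)) (σ i)) {x y : ℕ} (hxy : x < y) :
    pairColour n f σ x y % (leadingExponent σ + 1) = (diffEntry σ x y).1 := by
  have := diffEntry_fst_le hX hσ hdec hxy
  rw [pairColour, Nat.mul_add_mod', Nat.mod_eq_of_lt (by lia)]

theorem pairColour_div (hX : IsPartialOrderOn X le) (hσ : ∀ i, σ i ∈ omegaPower X le)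
    (hdec : ∀ i, omegaPowerLT le (σ (i + 1)) (σ i)) {x y : ℕ} (hxy : x < y) :
    pairColour n f σ x y / (leadingExponent σ + 1) = distinctValues n f x y := by
  have := diffEntry_fst_le hX hσ hdec hxy
  rw [pairColour, mul_comm, Nat.mul_add_div (by lia), Nat.div_eq_of_lt (by lia), add_zero]

end

theorem ortInstance_mem {p : ℕ → ℕ} (hp : p ∈ (ECT.parallelProd WOPOmegaPower).instances) :
    ortInstance p ∈ ORT.instances := by
  obtain ⟨-, hX, hσ, hdec⟩ := hp
  replace hX := hX.toIsPartialOrderOn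
  refine ⟨?_, fun x y hxy => ?_, fun x y y' hxy hy => ?_⟩
  · rw [ortLE_ortInstance]
    exact isPartialOrderOn_prodOrderCode _ _
  · rw [ortCard_ortInstance, ortColour_ortInstance, ← Nat.div_lt_iff_lt_mul (by lia),
      pairColour_div hX hσ hdec hxy]
    exact Nat.lt_succ_of_le (distinctValues_le _ _ _ _)
  · rw [ortLE_ortInstance, ortColour_ortInstance, ortColour_ortInstance, codedRel_prodOrderCode,
      pairColour_div hX hσ hdec hxy, pairColour_mod hX hσ hdec hxy,
      pairColour_div hX hσ hdec (hxy.trans_le hy), pairColour_mod hX hσ hdec (hxy.trans_le hy)]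
    exact ⟨distinctValues_mono _ _ hy, diffEntry_fst_mono hX hσ hdec hxy hy⟩

theorem ectWopSolution_mem {p : ℕ → ℕ} (hp : p ∈ (ECT.parallelProd WOPOmegaPower).instances)
    {h : ℕ → ℕ} (hh : h ∈ ORT.solutions (ortInstance p)) :
    ectWopSolution (join p h) ∈ (ECT.parallelProd WOPOmegaPower).solutions p := by
  obtain ⟨hf, hX, hσ, hdec⟩ := hp
  replace hX := hX.toIsPartialOrderOn
  obtain ⟨hinf, a, ha⟩ := hh
  have hmono := enumElem_strictMono hinf
  have hcol : ∀ i j, i < j → pairColour (fstPart p 0) (tailPart (fstPart p))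
      (wopSeq (sndPart p)) (enumElem h i) (enumElem h j) = a := fun i j hij => by
    rw [← ortColour_ortInstance]
    exact ha _ (enumElem_mem hinf i) _ (enumElem_mem hinf j) (hmono hij)
  have hsucc := fun i => hmono (Nat.lt_succ_self i)
  have hget := fun i => getElem?_firstDiff hX hσ hdec (hsucc i)
  simp only [Problem.parallelProd, ectWopSolution, fstPart_join, sndPart_join,
    Set.mem_ofPred_eq]
  refine ⟨fun x hx => ?_, fun i => ?_, fun i => ?_, enumElem h, fun i j hij => (hmono hij).le,
    fun i => ⟨_, List.mem_of_getElem? (hget i)⟩⟩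
  -- Write `h i` for the `i`-th element. As `x < h (x + 1)`, the point `x` lies in `[h 0, h (x +
  -- 2))`, which has as many values as `[h (x + 1), h (x + 2))`; so `f x` recurs beyond `x`.
  · have h1 : x + 1 ≤ enumElem h (x + 1) := hmono.id_le _
    have hdv : ∀ i j, i < j → distinctValues (fstPart p 0) (tailPart (fstPart p))
        (enumElem h i) (enumElem h j) = a / (leadingExponent (wopSeq (sndPart p)) + 1) :=
      fun i j hij => by rw [← hcol i j hij, pairColour_div hX hσ hdec (hmono hij)]
    have h2 := hsucc (x + 1)
    obtain ⟨y, hy, -, hxy⟩ := exists_value_of_distinctValues_eq hf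
      (hmono.monotone (Nat.zero_le (x + 1)))
      ((hdv 0 (x + 2) (by lia)).trans (hdv (x + 1) (x + 2) (by lia)).symm)
      (w := x) (le_of_lt hx) (by lia)
    exact ⟨y, by lia, hxy.symm⟩
  · exact ((hσ _).2 _ (List.mem_of_getElem? (hget i))).1
  · refine strictPart_diffEntry hX hσ hdec (hsucc i) (hsucc (i + 1)) ?_
    rw [← pairColour_mod hX hσ hdec (hsucc i), ← pairColour_mod hX hσ hdec (hsucc (i + 1)),
      hcol i _ (Nat.lt_succ_self _), hcol (i + 1) _ (Nat.lt_succ_self _)]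

theorem ect_prod_wop_reducible_ort :
    WeihrauchReducible (ECT.parallelProd WOPOmegaPower) ORT :=
  .of_computableOn computableOn_ortInstance (fun _ hp => ortInstance_mem hp)
    computableOn_ectWopSolution fun _ hp _ hh => ectWopSolution_mem hp hh

/-! ### Emitting the colours of a right-ordered colouring -/

instance (r : ℕ → ℕ) (a b : ℕ) : Decidable (codedRel r a b) :=
  inferInstanceAs (Decidable (_ ≠ _))

/-- The number of elements of `{0, …, k - 1}` strictly below `a` in the order coded by `r`. -/
def posetRank (k : ℕ) (r : ℕ → ℕ) (a : ℕ) : ℕ := Nat.count (fun b => codedRel r b a ∧ b ≠ a) k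

/-- An injective and strictly increasing map from the poset coded by `k` and `r` to `ℕ`. -/
def colourCode (k : ℕ) (r : ℕ → ℕ) (a : ℕ) : ℕ := posetRank k r a * k + a

/-- At stage `⟨x, d⟩`, emit the (positive) code of the colour of `(x, x + d + 1)` if this is a new
colour in column `x`, and `0` otherwise. -/
def emission (k : ℕ) (r C : ℕ → ℕ) (t : ℕ) : ℕ :=
  if t.unpair.2 = 0 ∨ C (Nat.pair t.unpair.1 (t.unpair.1 + t.unpair.2 + 1)) ≠
      C (Nat.pair t.unpair.1 (t.unpair.1 + t.unpair.2)) then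
    colourCode k r (C (Nat.pair t.unpair.1 (t.unpair.1 + t.unpair.2 + 1))) + 1
  else 0

section Emission

variable {k : ℕ} {r C : ℕ → ℕ}

theorem posetRank_lt (h : IsPartialOrderOn (Set.Iio k) (codedRel r)) {a b : ℕ} (ha : a < k)
    (hb : b < k) (hab : codedRel r a b) (hne : a ≠ b) : posetRank k r a < posetRank k r b := by
  simp only [posetRank, Nat.count_eq_card_filter_range]
  refine Finset.card_lt_card (Finset.ssubset_iff_of_subset (fun c hc => ?_) |>.2 ⟨a, ?_, ?_⟩)
  · simp only [Finset.mem_filter, Finset.mem_range] at hc ⊢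
    exact ⟨hc.1, h.strictPart_trans hc.1 ha hb hc.2 ⟨hab, hne⟩⟩
  · simpa using ⟨ha, hab, hne⟩
  · simp

/-- A larger rank adds at least `k`, which outweighs the summand `a < k`. -/
theorem colourCode_lt (h : IsPartialOrderOn (Set.Iio k) (codedRel r)) {a b : ℕ} (ha : a < k)
    (hb : b < k) (hab : codedRel r a b) (hne : a ≠ b) : colourCode k r a < colourCode k r b := by
  have := Nat.mul_le_mul_right k (posetRank_lt h ha hb hab hne)
  rw [Nat.succ_mul] at this
  simp only [colourCode]
  lia

theorem colourCode_injOn {a b : ℕ} (ha : a < k) (hb : b < k)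
    (h : colourCode k r a = colourCode k r b) : a = b := by
  have := congrArg (· % k) h
  simpa [colourCode, Nat.mul_add_mod', Nat.mod_eq_of_lt ha, Nat.mod_eq_of_lt hb] using this

theorem colourCode_lt_bound {a : ℕ} (ha : a < k) : colourCode k r a < (k + 1) * k := by
  have := Nat.mul_le_mul_right k (Nat.count_le (fun b => codedRel r b a ∧ b ≠ a) (n := k))
  rw [Nat.succ_mul]
  simp only [colourCode, posetRank]
  lia

theorem emission_lt (hC : IsPairColouring k fun x y => C (Nat.pair x y)) (t : ℕ) :
    emission k r C t < (k + 1) * k + 1 := by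
  rw [emission]
  split_ifs
  · exact Nat.succ_lt_succ (colourCode_lt_bound (hC _ _ (by lia)))
  · lia

theorem emission_eq {t v : ℕ} (hv : 0 < v) (h : emission k r C t = v) :
    (t.unpair.2 = 0 ∨ C (Nat.pair t.unpair.1 (t.unpair.1 + t.unpair.2 + 1)) ≠
      C (Nat.pair t.unpair.1 (t.unpair.1 + t.unpair.2))) ∧
    colourCode k r (C (Nat.pair t.unpair.1 (t.unpair.1 + t.unpair.2 + 1))) + 1 = v := by
  rw [emission] at h
  split_ifs at h with h1
  · exact ⟨h1, h⟩
  · lia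

theorem emission_pos (x : ℕ) : 0 < emission k r C (Nat.pair x 0) := by
  simp [emission]

theorem colour_eq_of_emission_eq (hC : IsPairColouring k fun x y => C (Nat.pair x y)) {t t' v : ℕ}
    (hv : 0 < v) (h : emission k r C t = v) (h' : emission k r C t' = v) :
    C (Nat.pair t.unpair.1 (t.unpair.1 + t.unpair.2 + 1)) =
      C (Nat.pair t'.unpair.1 (t'.unpair.1 + t'.unpair.2 + 1)) := by
  have h1 := (emission_eq hv h).2
  have h2 := (emission_eq hv h').2
  exact colourCode_injOn (k := k) (r := r) (hC _ _ (by lia)) (hC _ _ (by lia)) (by lia)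

/-- Within one column the colours increase. If a colour returned at a later stage, the colour just
before would be squeezed between equal ones, so nothing new would have been emitted. -/
theorem unpair_fst_injOn_emission (h : IsPartialOrderOn (Set.Iio k) (codedRel r))
    (hC : IsPairColouring k fun x y => C (Nat.pair x y))
    (hR : IsRightOrdered (codedRel r) fun x y => C (Nat.pair x y)) {v : ℕ} (hv : 0 < v) :
    Set.InjOn (fun t => t.unpair.1) {t | emission k r C t = v} := by
  have key : ∀ t t' : ℕ, emission k r C t = v → emission k r C t' = v →
      t.unpair.1 = t'.unpair.1 → ¬ t.unpair.2 < t'.unpair.2 := by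
    intro t t' ht ht' he hlt
    have hcol := colour_eq_of_emission_eq hC hv ht ht'
    have hne := (emission_eq hv ht').1
    rw [he] at hcol
    have h1 := hR t'.unpair.1 (t'.unpair.1 + t.unpair.2 + 1) (t'.unpair.1 + t'.unpair.2)
      (by lia) (by lia)
    have h2 := hR t'.unpair.1 (t'.unpair.1 + t'.unpair.2) (t'.unpair.1 + t'.unpair.2 + 1)
      (by lia) (by lia)
    simp only [hcol] at h1
    rcases hne with h0 | hne
    · lia
    · exact hne (h.antisymm _ (hC _ _ (by lia)) _ (hC _ _ (by lia)) h1 h2)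
  intro t ht t' ht' he
  have he' : t.unpair.2 = t'.unpair.2 :=
    le_antisymm (not_lt.1 (key t' t ht' ht he.symm)) (not_lt.1 (key t t' ht ht' he))
  rw [← Nat.pair_unpair t, ← Nat.pair_unpair t', he']
  exact congrArg (Nat.pair · _) he

/-- If no emission after stage `b` exceeds `v`, then a column `x > b` in which `v` is emitted keeps
its colour. -/
theorem colour_eq_of_emission_le (h : IsPartialOrderOn (Set.Iio k) (codedRel r))
    (hC : IsPairColouring k fun x y => C (Nat.pair x y))
    (hR : IsRightOrdered (codedRel r) fun x y => C (Nat.pair x y)) {b v : ℕ} (hv : 0 < v)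
    (hb : ∀ t > b, emission k r C t ≤ v) {t : ℕ} (ht : emission k r C t = v)
    (hbt : b < t.unpair.1) {y : ℕ} (hy : t.unpair.1 + t.unpair.2 + 1 ≤ y) :
    C (Nat.pair t.unpair.1 y) = C (Nat.pair t.unpair.1 (t.unpair.1 + t.unpair.2 + 1)) := by
  induction y, hy using Nat.le_induction with
  | base => rfl
  | succ y hy ih =>
    by_contra hne
    rw [← ih] at hne
    have hlt := colourCode_lt h (hC t.unpair.1 y (by lia)) (hC t.unpair.1 (y + 1) (by lia))
      (hR t.unpair.1 y (y + 1) (by lia) (by lia)) (Ne.symm hne)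
    -- A change of colour from `y` to `y + 1` is emitted at this stage, which is at least the column
    -- number and hence after `b`; its code would exceed `v`.
    have hle := hb (Nat.pair t.unpair.1 (y - t.unpair.1)) (hbt.trans_le (Nat.left_le_pair _ _))
    rw [emission] at hle
    simp only [Nat.unpair_pair, Nat.add_sub_cancel' (show t.unpair.1 ≤ y by lia)] at hle
    rw [if_pos (Or.inr hne)] at hle
    have := (emission_eq hv ht).2
    simp only at hlt
    rw [ih] at hlt
    lia

end Emission

/-! ### The largest recurrent value of a sequence -/

/-- One more than the last stage before `t` at which `R` holds, and `0` if there is none. -/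
def lastTime (R : ℕ → Prop) [DecidablePred R] (t : ℕ) : ℕ :=
  Nat.rec 0 (fun s ih => if R s then s + 1 else ih) t

section LastTime

variable {R : ℕ → Prop} [DecidablePred R]

theorem lastTime_succ (t : ℕ) :
    lastTime R (t + 1) = if R t then t + 1 else lastTime R t := rfl

theorem lastTime_le (t : ℕ) : lastTime R t ≤ t := by
  induction t with
  | zero => exact le_rfl
  | succ t ih =>
    rw [lastTime_succ]
    split_ifs <;> lia

theorem lt_lastTime {s t : ℕ} (hs : R s) (hst : s < t) : s < lastTime R t := by
  induction t, hst using Nat.le_induction with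
  | base => simp [lastTime_succ, hs]
  | succ t hst ih =>
    rw [lastTime_succ]
    split_ifs <;> lia

theorem lastTime_spec {t : ℕ} (h : 0 < lastTime R t) : R (lastTime R t - 1) := by
  induction t with
  | zero => exact absurd h (lt_irrefl 0)
  | succ t ih =>
    by_cases ht : R t
    · simp [lastTime_succ, ht]
    · simp only [lastTime_succ, ht, if_false] at h ⊢
      exact ih h

end LastTime

/-- The coefficient at exponent `e` and stage `t`: it codes `e`, the last time at which `f` took a
value above `e`, and the last time at which `f` took the value `e`. -/
def timeCoeff (f : ℕ → ℕ) (t e : ℕ) : ℕ :=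
  Nat.pair e (Nat.pair (lastTime (fun s => e < f s) t) (lastTime (fun s => f s = e) t))

/-- The element of `X^ω` with the coefficients `timeCoeff f t e` at the exponents `e < n`. -/
def timeSeq (f : ℕ → ℕ) (n t : ℕ) : List (ℕ × ℕ) :=
  Nat.rec [] (fun e l => (e, timeCoeff f t e) :: l) n

/-- The order `ω × ω × ω*` on codes of triples. -/
def timeLE (u v : ℕ) : Prop :=
  u.unpair.1 < v.unpair.1 ∨ u.unpair.1 = v.unpair.1 ∧
    (u.unpair.2.unpair.1 < v.unpair.2.unpair.1 ∨
      u.unpair.2.unpair.1 = v.unpair.2.unpair.1 ∧ v.unpair.2.unpair.2 ≤ u.unpair.2.unpair.2)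

instance (u v : ℕ) : Decidable (timeLE u v) := inferInstanceAs (Decidable (_ ∨ _))

theorem ext_unpair {u v : ℕ} (h1 : u.unpair.1 = v.unpair.1)
    (h2 : u.unpair.2.unpair.1 = v.unpair.2.unpair.1)
    (h3 : u.unpair.2.unpair.2 = v.unpair.2.unpair.2) : u = v := by
  rw [← Nat.pair_unpair u, ← Nat.pair_unpair v, ← Nat.pair_unpair u.unpair.2,
    ← Nat.pair_unpair v.unpair.2, h1, h2, h3]

theorem isLinearOrderOn_timeLE (X : Set ℕ) : IsLinearOrderOn X timeLE where
  refl a _ := by simp [timeLE]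
  antisymm a _ b _ h h' := by
    simp only [timeLE] at h h'
    exact ext_unpair (by lia) (by lia) (by lia)
  trans a _ b _ c _ h h' := by
    simp only [timeLE] at *
    lia
  total a _ b _ := by
    simp only [timeLE]
    lia

theorem strictPart_timeLE {u v : ℕ} : strictPart timeLE u v ↔
    u.unpair.1 < v.unpair.1 ∨ u.unpair.1 = v.unpair.1 ∧
    (u.unpair.2.unpair.1 < v.unpair.2.unpair.1 ∨
      u.unpair.2.unpair.1 = v.unpair.2.unpair.1 ∧
        v.unpair.2.unpair.2 < u.unpair.2.unpair.2) := by
  constructor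
  · rintro ⟨h, hne⟩
    have : ¬ (u.unpair.1 = v.unpair.1 ∧ u.unpair.2.unpair.1 = v.unpair.2.unpair.1 ∧
      u.unpair.2.unpair.2 = v.unpair.2.unpair.2) := fun ⟨h1, h2, h3⟩ => hne (ext_unpair h1 h2 h3)
    simp only [timeLE] at h
    lia
  · intro h
    refine ⟨?_, ?_⟩
    · simp only [timeLE]
      lia
    · rintro rfl
      lia

/-- Raising the reversed third component goes strictly down. Without a least element, every number
is a legitimate coefficient. -/
theorem not_forall_timeLE (u : ℕ) : ¬ ∀ x ∈ Set.univ, timeLE u x := by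
  intro h
  have := h (Nat.pair u.unpair.1 (Nat.pair u.unpair.2.unpair.1 (u.unpair.2.unpair.2 + 1)))
    (Set.mem_univ _)
  simp [timeLE] at this

/-! ### Decreasing sequences of time coefficients find the largest recurrent value. -/

section TimeSeq

variable {f : ℕ → ℕ} {n : ℕ}

theorem mem_timeSeq {t : ℕ} {u : ℕ × ℕ} :
    u ∈ timeSeq f n t ↔ u.1 < n ∧ u.2 = timeCoeff f t u.1 := by
  induction n with
  | zero => simp [timeSeq]
  | succ n ih =>
    change u ∈ (n, timeCoeff f t n) :: timeSeq f n t ↔ _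
    rw [List.mem_cons, ih, Prod.ext_iff]
    constructor
    · rintro (⟨h1, h2⟩ | ⟨h1, h2⟩)
      · exact ⟨by lia, by rw [h2, h1]⟩
      · exact ⟨by lia, h2⟩
    · rintro ⟨h1, h2⟩
      rcases (Nat.lt_succ_iff_lt_or_eq.1 h1) with h | h
      · exact Or.inr ⟨h, h2⟩
      · exact Or.inl ⟨h, by rw [h2, h]⟩

theorem timeSeq_mem_omegaPower (t : ℕ) : timeSeq f n t ∈ omegaPower Set.univ timeLE := by
  refine ⟨?_, fun u _ => ⟨Set.mem_univ _, not_forall_timeLE _⟩⟩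
  induction n with
  | zero => exact List.Pairwise.nil
  | succ n ih => exact List.Pairwise.cons (fun u hu => (mem_timeSeq.1 hu).1) ih

theorem timeSeq_decreasing {t : ℕ} (h : f t < n) :
    omegaPowerLT timeLE (timeSeq f n (t + 1)) (timeSeq f n t) := by
  induction n with
  | zero => lia
  | succ n ih =>
    change List.Lex _ ((n, timeCoeff f (t + 1) n) :: timeSeq f n (t + 1))
      ((n, timeCoeff f t n) :: timeSeq f n t)
    rcases Nat.lt_succ_iff_lt_or_eq.1 h with h | h
    -- At an exponent above `f t`, neither recorded time changes.
    · have : timeCoeff f (t + 1) n = timeCoeff f t n := by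
        simp [timeCoeff, lastTime_succ, h.ne, h.not_gt]
      rw [this]
      exact List.Lex.cons (ih h)
    -- At the exponent `f t`, the last time of a larger value stays and the last time of the value
    -- itself jumps to `t + 1`, a drop in `ω*`. Changes at lower exponents do not matter.
    · refine List.Lex.rel (Prod.Lex.right _ (strictPart_timeLE.2 (Or.inr ⟨by simp [timeCoeff],
        Or.inr ⟨?_, ?_⟩⟩)))
      · simp [timeCoeff, lastTime_succ, h]
      · have := lastTime_le (R := fun s => f s = n) t
        simp only [timeCoeff, lastTime_succ, h, Nat.unpair_pair, if_true]
        lia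

/-- `ECT` promises only one further occurrence; iterating yields arbitrarily late ones. -/
theorem recurrent_of_lt {b : ℕ} (hb : ∀ x > b, ∃ y > x, f x = f y) {x : ℕ} (hx : b < x) (m : ℕ) :
    ∃ y > m, f y = f x := by
  induction m with
  | zero => exact ⟨x, by lia, rfl⟩
  | succ m ih =>
    obtain ⟨y, hy, hyx⟩ := ih
    by_cases hby : b < y
    · obtain ⟨z, hz, hyz⟩ := hb y hby
      exact ⟨z, by lia, hyz.symm.trans hyx⟩
    · exact ⟨x, by lia, rfl⟩

variable {s : ℕ → ℕ}

/-- A decreasing sequence for `timeLE` has eventually constant first and second components and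
strictly increasing third components. -/
theorem eventually_of_decreasing (hdec : ∀ i, strictPart timeLE (s (i + 1)) (s i)) :
    Antitone (fun i => (s i).unpair.1) ∧ ∃ i₀, ∀ i,
      (s (i₀ + i)).unpair.1 = (s i₀).unpair.1 ∧
      (s (i₀ + i)).unpair.2.unpair.1 = (s i₀).unpair.2.unpair.1 ∧
      i ≤ (s (i₀ + i)).unpair.2.unpair.2 := by
  have hanti : Antitone fun i => toLex ((s i).unpair.1, (s i).unpair.2.unpair.1) := by
    refine antitone_nat_of_succ_le fun i => ?_
    have := strictPart_timeLE.1 (hdec i)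
    rw [Prod.Lex.toLex_le_toLex]
    simp only
    lia
  refine ⟨antitone_nat_of_succ_le fun i => ?_, ?_⟩
  · have := strictPart_timeLE.1 (hdec i)
    lia
  -- The first two components form a nonincreasing sequence in the well-order `ω × ω`, so they
  -- stabilise; from then on only the third can account for the decrease.
  obtain ⟨i₀, h⟩ := wellFoundedGT_iff_monotone_chain_condition.1
    (inferInstance : WellFoundedGT (Lex (ℕ × ℕ))ᵒᵈ) ⟨_, hanti.dual_right⟩
  have hc : ∀ i, (s (i₀ + i)).unpair.1 = (s i₀).unpair.1 ∧
      (s (i₀ + i)).unpair.2.unpair.1 = (s i₀).unpair.2.unpair.1 := fun i => by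
    have := h (i₀ + i) (by lia)
    simpa [eq_comm] using this
  refine ⟨i₀, fun i => ⟨(hc i).1, (hc i).2, ?_⟩⟩
  induction i with
  | zero => exact Nat.zero_le _
  | succ i ih =>
    have := strictPart_timeLE.1 (hdec (i₀ + i))
    have h1 := hc i
    have h2 := hc (i + 1)
    rw [← add_assoc] at h2 ⊢
    lia

theorem exists_lt_time (hdec : ∀ i, strictPart timeLE (s (i + 1)) (s i)) (b : ℕ) :
    ∃ i, b < (s i).unpair.2.unpair.2 := by
  obtain ⟨-, i₀, h⟩ := eventually_of_decreasing hdec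
  exact ⟨_, (h (b + 1)).2.2⟩

theorem max_recurrent {b : ℕ} (hb : ∀ x > b, ∃ y > x, f x = f y)
    (hdec : ∀ i, strictPart timeLE (s (i + 1)) (s i)) (hs : IsContainedIn s (timeSeq f n)) {i : ℕ}
    (hi : b + 1 < (s i).unpair.2.unpair.2) :
    (∀ m, ∃ t > m, f t = (s i).unpair.1) ∧ ∀ t > b, f t ≤ (s i).unpair.1 := by
  obtain ⟨τ, -, hτ⟩ := hs
  have hs : ∀ i, s i = timeCoeff f (τ i) (s i).unpair.1 := fun i => by
    obtain ⟨e, he⟩ := hτ i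
    have h := (mem_timeSeq.1 he).2
    simp only at h
    have h' : (s i).unpair.1 = e := by simp [h, timeCoeff]
    rw [h', h]
  have hT : ∀ i, (s i).unpair.2.unpair.1 = lastTime (fun t => (s i).unpair.1 < f t) (τ i) :=
    fun i => by conv_lhs => rw [hs i]; simp [timeCoeff]
  have hK : ∀ i, (s i).unpair.2.unpair.2 = lastTime (fun t => f t = (s i).unpair.1) (τ i) :=
    fun i => by conv_lhs => rw [hs i]; simp [timeCoeff]
  obtain ⟨hanti, i₀, h⟩ := eventually_of_decreasing hdec
  -- A later, larger value at time `t` would be noticed at index `i₀ + (t + 1)`: its third component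
  -- is at least `t + 1`, so its stage is past `t`, and the second component would have to exceed
  -- its constant value.
  have hbound : ∀ t > (s i₀).unpair.2.unpair.1, f t ≤ (s i₀).unpair.1 := by
    intro t ht
    by_contra! hlt
    obtain ⟨h1, h2, h3⟩ := h (t + 1)
    have hle := lastTime_le (R := fun u => f u = (s (i₀ + (t + 1))).unpair.1) (τ (i₀ + (t + 1)))
    rw [← hK] at hle
    have := lt_lastTime (R := fun u => (s (i₀ + (t + 1))).unpair.1 < f u) (s := t)
      (t := τ (i₀ + (t + 1))) (by simpa [h1] using hlt) (by lia)
    rw [← hT] at this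
    lia
  have hle : ∀ t > b, f t ≤ (s i₀).unpair.1 := fun t ht => by
    obtain ⟨y, hy, hyt⟩ := recurrent_of_lt hb ht (s i₀).unpair.2.unpair.1
    exact hyt ▸ hbound y hy
  have hge : (s i₀).unpair.1 ≤ (s i).unpair.1 := by
    rw [← (h i).1]
    exact hanti (Nat.le_add_left i i₀)
  -- Recorded times are shifted by one, so this argument is an actual occurrence, and by `hi` it
  -- lies after `b`. Hence the exponent is recurrent.
  have hval : f ((s i).unpair.2.unpair.2 - 1) = (s i).unpair.1 := by
    have := lastTime_spec (R := fun t => f t = (s i).unpair.1) (t := τ i) (by rw [← hK]; lia)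
    rwa [← hK] at this
  refine ⟨fun m => ?_, fun t ht => (hle t ht).trans hge⟩
  obtain ⟨t, ht, hft⟩ := recurrent_of_lt hb (x := (s i).unpair.2.unpair.2 - 1) (by lia) m
  exact ⟨t, ht, hft.trans hval⟩

end TimeSeq

/-! ### Thinning out to a homogeneous set -/

/-- The first stage in a column `x ≥ m` at which `v` is emitted. -/
noncomputable def nextStage (f : ℕ → ℕ) (v m : ℕ) : ℕ :=
  sInf {t | f t = v ∧ m ≤ t.unpair.1}

/-- The lower bound for the `i`-th column that is chosen. -/
noncomputable def columnBound (f : ℕ → ℕ) (v b i : ℕ) : ℕ :=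
  Nat.rec (b + 1)
    (fun _ m => (nextStage f v m).unpair.1 + (nextStage f v m).unpair.2 + 1) i

/-- The `i`-th column that is chosen. -/
noncomputable def column (f : ℕ → ℕ) (v b i : ℕ) : ℕ :=
  (nextStage f v (columnBound f v b i)).unpair.1

/-- The characteristic function of the set of columns that are chosen. -/
noncomputable def columnSet (f : ℕ → ℕ) (v b m : ℕ) : ℕ :=
  Nat.count (fun i => column f v b i = m) (m + 1)

section Column

variable {f : ℕ → ℕ} {v b : ℕ}

theorem nextStage_spec (h : ∀ m, ∃ t, f t = v ∧ m ≤ t.unpair.1) (m : ℕ) :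
    f (nextStage f v m) = v ∧ m ≤ (nextStage f v m).unpair.1 :=
  Nat.sInf_mem (s := {t | f t = v ∧ m ≤ t.unpair.1}) (h m)

/-- The next column lies beyond the point at which the current one has reached the colour coded by
`v`, so this pair and all later ones in the column can get that colour. -/
theorem column_add_lt (h : ∀ m, ∃ t, f t = v ∧ m ≤ t.unpair.1) (i : ℕ) :
    column f v b i + (nextStage f v (columnBound f v b i)).unpair.2 < column f v b (i + 1) :=
  (nextStage_spec h (columnBound f v b (i + 1))).2

theorem column_strictMono (h : ∀ m, ∃ t, f t = v ∧ m ≤ t.unpair.1) :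
    StrictMono (column f v b) :=
  strictMono_nat_of_lt_succ fun i => lt_of_le_of_lt (Nat.le_add_right _ _) (column_add_lt h i)

theorem lt_column (h : ∀ m, ∃ t, f t = v ∧ m ≤ t.unpair.1) (i : ℕ) : b < column f v b i :=
  lt_of_lt_of_le (nextStage_spec h (b + 1)).2 ((column_strictMono h).monotone (Nat.zero_le i))

theorem codedSet_columnSet (h : ∀ m, ∃ t, f t = v ∧ m ≤ t.unpair.1) :
    codedSet (columnSet f v b) = Set.range (column f v b) := by
  ext m
  change columnSet f v b m ≠ 0 ↔ _
  rw [← Nat.pos_iff_ne_zero, columnSet, count_pos_iff_exists]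
  refine ⟨fun ⟨i, _, hi⟩ => ⟨i, hi⟩, fun ⟨i, hi⟩ => ⟨i, ?_, hi⟩⟩
  -- The `i`-th column is at least `i`, so membership of `m` is decided by the indices up to `m`.
  exact Nat.lt_succ_of_le (hi ▸ (column_strictMono h).id_le i)

end Column

section

variable {k : ℕ} {r C : ℕ → ℕ} {b v : ℕ}

theorem pos_of_emission_le (hb : ∀ t > b, emission k r C t ≤ v) : 0 < v :=
  (emission_pos (b + 1)).trans_le
    (hb _ (lt_of_lt_of_le (Nat.lt_succ_self b) (Nat.left_le_pair _ _)))

/-- Infinitely many stages emit `v`, at most one in each column, so the columns are unbounded and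
the search in `nextStage` halts. -/
theorem exists_column (h : IsPartialOrderOn (Set.Iio k) (codedRel r))
    (hC : IsPairColouring k fun x y => C (Nat.pair x y))
    (hR : IsRightOrdered (codedRel r) fun x y => C (Nat.pair x y))
    (hb : ∀ t > b, emission k r C t ≤ v) (hinf : ∀ m, ∃ t > m, emission k r C t = v) (m : ℕ) :
    ∃ t, emission k r C t = v ∧ m ≤ t.unpair.1 := by
  have hset : {t | emission k r C t = v}.Infinite :=
    Set.infinite_of_forall_exists_gt fun m => (hinf m).imp fun t ht => ht.symm
  obtain ⟨_, ⟨t, ht, rfl⟩, hm⟩ :=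
    (hset.image (unpair_fst_injOn_emission h hC hR (pos_of_emission_le hb))).exists_gt m
  exact ⟨t, ht, hm.le⟩

theorem columnSet_homogeneous (h : IsPartialOrderOn (Set.Iio k) (codedRel r))
    (hC : IsPairColouring k fun x y => C (Nat.pair x y))
    (hR : IsRightOrdered (codedRel r) fun x y => C (Nat.pair x y))
    (hb : ∀ t > b, emission k r C t ≤ v) (hinf : ∀ m, ∃ t > m, emission k r C t = v) :
    (codedSet (columnSet (emission k r C) v b)).Infinite ∧
      IsHomogeneous (fun x y => C (Nat.pair x y)) (codedSet (columnSet (emission k r C) v b)) := by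
  have hex := exists_column h hC hR hb hinf
  have hv := pos_of_emission_le hb
  have hmono := column_strictMono (b := b) hex
  rw [codedSet_columnSet hex]
  refine ⟨Set.infinite_range_of_injective hmono.injective, C (Nat.pair (column (emission k r C) v b 0)
    (column (emission k r C) v b 0 + (nextStage (emission k r C) v (columnBound (emission k r C) v b 0)).unpair.2 + 1)), ?_⟩
  rintro _ ⟨i, rfl⟩ _ ⟨j, rfl⟩ hij
  have hij : i + 1 ≤ j := hmono.lt_iff_lt.1 hij
  have hle := hmono.monotone hij
  have hlt := column_add_lt (b := b) hex i
  exact (colour_eq_of_emission_le h hC hR hv hb (nextStage_spec hex _).1 (lt_column hex i)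
    (hlt.trans_le hle)).trans
    (colour_eq_of_emission_eq hC hv (nextStage_spec hex _).1 (nextStage_spec hex _).1)

end

/-! ### `ORT ≤ ECT × WOP` -/

/-- The emission sequence of an instance of `ORT`. -/
def ortEmission (p : ℕ → ℕ) : ℕ → ℕ := emission (ortCard p) (tailPart (fstPart p)) (sndPart p)

/-- A bound for the values of the emission sequence of an instance of `ORT`. -/
def ortBound (p : ℕ → ℕ) : ℕ := (ortCard p + 1) * ortCard p + 1

/-- The instance of `ECT × WOP` obtained from an instance of `ORT`. -/
def ectWopInstance (p : ℕ → ℕ) : ℕ → ℕ :=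
  join (consPart (ortBound p) (ortEmission p))
    (join (join (fun _ => 1) fun m => if timeLE m.unpair.1 m.unpair.2 then 1 else 0)
      fun t => encode (timeSeq (ortEmission p) (ortBound p) t))

/-- The first index at which a solution `s` of the instance of `WOP` refers to a stage after
`b`. -/
noncomputable def lateIndex (b : ℕ) (s : ℕ → ℕ) : ℕ :=
  sInf {i | b + 1 < (s i).unpair.2.unpair.2}

/-- The solution of an instance of `ORT` obtained from a solution of `ECT × WOP`. -/
noncomputable def ortSolution (q : ℕ → ℕ) : ℕ → ℕ :=
  columnSet (ortEmission (fstPart q))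
    (sndPart (sndPart q) (lateIndex (fstPart (sndPart q) 0) (sndPart (sndPart q)))).unpair.1
    (fstPart (sndPart q) 0)

theorem fstPart_ectWopInstance (p : ℕ → ℕ) :
    fstPart (ectWopInstance p) = consPart (ortBound p) (ortEmission p) := by
  simp [ectWopInstance]

theorem wopSet_ectWopInstance (p : ℕ → ℕ) :
    wopSet (sndPart (ectWopInstance p)) = Set.univ := by
  simp [ectWopInstance, wopSet, codedSet]

theorem wopLE_ectWopInstance (p : ℕ → ℕ) :
    wopLE (sndPart (ectWopInstance p)) = timeLE := by
  ext a b
  simp [ectWopInstance, wopLE, codedRel]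

theorem wopSeq_ectWopInstance (p : ℕ → ℕ) :
    wopSeq (sndPart (ectWopInstance p)) = timeSeq (ortEmission p) (ortBound p) := by
  ext1 t
  exact wopSeq_encode _ _ _ (by simp [ectWopInstance])

theorem ectWopInstance_mem {p : ℕ → ℕ} (hp : p ∈ ORT.instances) :
    ectWopInstance p ∈ (ECT.parallelProd WOPOmegaPower).instances := by
  have hlt : ∀ t, ortEmission p t < ortBound p := emission_lt hp.2.1
  refine ⟨?_, ?_, ?_⟩
  · rw [fstPart_ectWopInstance]
    simpa [ECT] using hlt
  · rw [wopLE_ectWopInstance]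
    exact isLinearOrderOn_timeLE _
  · rw [wopLE_ectWopInstance, wopSet_ectWopInstance, wopSeq_ectWopInstance]
    exact ⟨timeSeq_mem_omegaPower, fun t => timeSeq_decreasing (hlt t)⟩

theorem exists_lateIndex {p y : ℕ → ℕ}
    (hy : y ∈ (ECT.parallelProd WOPOmegaPower).solutions (ectWopInstance p)) :
    ∃ i, fstPart y 0 + 1 < (sndPart y i).unpair.2.unpair.2 := by
  obtain ⟨-, -, hdec, -⟩ := hy
  rw [wopLE_ectWopInstance] at hdec
  exact exists_lt_time hdec _

theorem max_recurrent_ortEmission {p y : ℕ → ℕ}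
    (hy : y ∈ (ECT.parallelProd WOPOmegaPower).solutions (ectWopInstance p)) :
    (∀ m, ∃ t > m, ortEmission p t =
      (sndPart y (lateIndex (fstPart y 0) (sndPart y))).unpair.1) ∧
    ∀ t > fstPart y 0, ortEmission p t ≤
      (sndPart y (lateIndex (fstPart y 0) (sndPart y))).unpair.1 := by
  have hi := Nat.sInf_mem (exists_lateIndex hy)
  obtain ⟨hb, -, hdec, hs⟩ := hy
  rw [wopLE_ectWopInstance] at hdec
  rw [wopSeq_ectWopInstance] at hs
  rw [fstPart_ectWopInstance] at hb
  exact max_recurrent (by simpa [ECT] using hb) hdec hs hi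

theorem ortSolution_mem {p y : ℕ → ℕ} (hp : p ∈ ORT.instances)
    (hy : y ∈ (ECT.parallelProd WOPOmegaPower).solutions (ectWopInstance p)) :
    ortSolution (join p y) ∈ ORT.solutions p := by
  obtain ⟨h, hC, hR⟩ := hp
  obtain ⟨h1, h2⟩ := max_recurrent_ortEmission hy
  rw [ortSolution, fstPart_join, sndPart_join]
  exact columnSet_homogeneous h hC hR h2 h1

/-! ### Computability of the reduction of `ORT` to `ECT × WOP`. -/

namespace ComputableOn

variable {α : Type*} [Primcodable α] {D : Set (ℕ → ℕ)}

theorem emission {r C : (ℕ → ℕ) → ℕ → ℕ} (hr : ComputableOn D r) (hC : ComputableOn D C)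
    {k : (ℕ → ℕ) → α → ℕ} (hk : ComputableOn D k) {t : (ℕ → ℕ) → α → ℕ} (ht : ComputableOn D t) :
    ComputableOn D fun p a => emission (k p a) (r p) (C p) (t p a) := by
  have h1 := hC.comp (natPair ht.unpair_fst (add ht.unpair_fst ht.unpair_snd).succ)
  have h2 := hC.comp (natPair ht.unpair_fst (add ht.unpair_fst ht.unpair_snd))
  have hrank : ComputableOn D fun p (x : ℕ × ℕ) => posetRank x.1 (r p) x.2 :=
    count (.and (.codedRel hr id.snd id.fst.snd) (.not (.eq id.snd id.fst.snd))) id.fst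
  exact ite (.or (.eq ht.unpair_snd (const 0)) (.not (.eq h1 h2)))
    (add (mul (hrank.comp (hk.pair h1)) hk) h1).succ (const 0)

theorem ortEmission {r : (ℕ → ℕ) → ℕ → ℕ} (hr : ComputableOn D r) :
    ComputableOn D fun p => ortEmission (r p) :=
  emission hr.fstPart.tailPart hr.sndPart (hr.fstPart.comp (const 0)) id

theorem lastTime {R : (ℕ → ℕ) → α → ℕ → Prop} [∀ p a, DecidablePred (R p a)]
    {t : (ℕ → ℕ) → α → ℕ} (hR : DecidableOn D fun p (x : α × ℕ) => R p x.1 x.2)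
    (ht : ComputableOn D t) : ComputableOn D fun p a => lastTime (R p a) (t p a) :=
  natRec (const 0) (g := fun p (x : α × ℕ × ℕ) => if R p x.1 x.2.1 then x.2.1 + 1 else x.2.2)
    (ite (hR.comp (id.fst.pair id.snd.fst)) id.snd.fst.succ id.snd.snd) ht

theorem timeSeq {f : (ℕ → ℕ) → ℕ → ℕ} (hf : ComputableOn D f) {n t : (ℕ → ℕ) → α → ℕ}
    (hn : ComputableOn D n) (ht : ComputableOn D t) :
    ComputableOn D fun p a => timeSeq (f p) (n p a) (t p a) := by
  have hc : ComputableOn D fun p (x : ℕ × ℕ) => timeCoeff (f p) x.1 x.2 :=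
    natPair id.snd (natPair (lastTime (.lt id.fst.snd (hf.comp id.snd)) id.fst)
      (lastTime (.eq (hf.comp id.snd) id.fst.snd) id.fst))
  exact natRec (const []) (g := fun p (x : α × ℕ × List (ℕ × ℕ)) =>
      (x.2.1, timeCoeff (f p) (t p x.1) x.2.1) :: x.2.2)
    (map₂ Primrec.list_cons
      (pair id.snd.fst (hc.comp (pair (ht.comp id.fst) id.snd.fst))) id.snd.snd) hn

theorem ectWopInstance : ComputableOn D ectWopInstance := by
  have hk : ComputableOn D fun p (_ : ℕ) => ortCard p := (fstPart oracle).comp (const 0)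
  have hb : ComputableOn D fun p (_ : ℕ) => ortBound p := (mul hk.succ hk).succ
  have hf : ComputableOn D fun p => _root_.ortEmission p := ortEmission oracle
  have h1 : ComputableOn D fun _ (m : ℕ) => m.unpair.1 := unpair_fst id
  have h2 : ComputableOn D fun _ (m : ℕ) => m.unpair.2.unpair.1 := (unpair_snd id).unpair_fst
  have h3 : ComputableOn D fun _ (m : ℕ) => m.unpair.2.unpair.2 := (unpair_snd id).unpair_snd
  have hu : ComputableOn D fun _ (m : ℕ) => m.unpair.2 := unpair_snd id
  exact join (consPart hb hf) (join (join (const 1)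
    (ite (.or (.lt (h1.comp h1) (h1.comp hu)) (.and (.eq (h1.comp h1) (h1.comp hu))
      (.or (.lt (h2.comp h1) (h2.comp hu)) (.and (.eq (h2.comp h1) (h2.comp hu))
        (.le (h3.comp hu) (h3.comp h1)))))) (const 1) (const 0)))
    (map₁ Primrec.encode (timeSeq hf hb id)))

theorem columnSet {f : (ℕ → ℕ) → ℕ → ℕ} (hf : ComputableOn D f) {v b : (ℕ → ℕ) → ℕ}
    (hv : ComputableOn D fun p (_ : ℕ) => v p) (hb : ComputableOn D fun p (_ : ℕ) => b p)
    (h : ∀ p ∈ D, ∀ m, ∃ t, f p t = v p ∧ m ≤ t.unpair.1) :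
    ComputableOn D fun p => columnSet (f p) (v p) (b p) := by
  have hnext : ComputableOn D fun p => nextStage (f p) (v p) :=
    search (R := fun p m t => f p t = v p ∧ m ≤ t.unpair.1)
      (.and (.eq (hf.comp id.snd) (hv.comp id.fst)) (.le id.fst id.snd.unpair_fst)) h
  have hbd : ComputableOn D fun p => columnBound (f p) (v p) (b p) :=
    natRec hb.succ (g := fun p (x : ℕ × ℕ × ℕ) => (nextStage (f p) (v p) x.2.2).unpair.1 +
        (nextStage (f p) (v p) x.2.2).unpair.2 + 1)
      (add (hnext.comp id.snd.snd).unpair_fst (hnext.comp id.snd.snd).unpair_snd).succ id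
  have hcol : ComputableOn D fun p => column (f p) (v p) (b p) := (hnext.comp hbd).unpair_fst
  exact count (.eq (hcol.comp id.snd) id.fst) id.succ

end ComputableOn

theorem computableOn_ortSolution : ComputableOn {q | fstPart q ∈ ORT.instances ∧
    sndPart q ∈ (ECT.parallelProd WOPOmegaPower).solutions (ectWopInstance (fstPart q))}
    ortSolution := by
  set D := {q | fstPart q ∈ ORT.instances ∧
    sndPart q ∈ (ECT.parallelProd WOPOmegaPower).solutions (ectWopInstance (fstPart q))}
  have hs : ComputableOn D fun q => sndPart (sndPart q) := .sndPart (.sndPart .oracle)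
  have hb : ComputableOn D fun q (_ : ℕ) => fstPart (sndPart q) 0 :=
    (ComputableOn.fstPart (.sndPart .oracle)).comp (.const 0)
  have hi : ComputableOn D fun q (_ : ℕ) =>
      lateIndex (fstPart (sndPart q) 0) (sndPart (sndPart q)) :=
    .search (R := fun q _ i =>
        fstPart (sndPart q) 0 + 1 < (sndPart (sndPart q) i).unpair.2.unpair.2)
      (.lt (hb.comp (.fst .id)).succ (hs.comp (.snd .id)).unpair_snd.unpair_snd)
      fun q hq _ => exists_lateIndex hq.2
  refine .columnSet (.ortEmission (.fstPart .oracle)) (hs.comp hi).unpair_fst hb fun q hq => ?_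
  obtain ⟨h1, h2⟩ := max_recurrent_ortEmission hq.2
  exact exists_column hq.1.1 hq.1.2.1 hq.1.2.2 h2 h1

theorem ort_reducible_ect_prod_wop :
    WeihrauchReducible ORT (ECT.parallelProd WOPOmegaPower) :=
  .of_computableOn .ectWopInstance (fun _ hp => ectWopInstance_mem hp)
    computableOn_ortSolution fun _ hp _ hy => ortSolution_mem hp hy

theorem mainTheorem1 :
    WeihrauchEquivalent ORT (ECT.parallelProd WOPOmegaPower) :=
  ⟨ort_reducible_ect_prod_wop, ect_prod_wop_reducible_ort⟩
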